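/- **Problem (ROPAS).** An instance consists of a dag $G$ on $t$ tasks and $n$ workers, where worker $i$ succeeds on task $j$ with probability $p_{i,j}\in[0,1]$, and for each task $j$ some $p_{i,j}>0$. A set $X$ of tasks is *precedence-closed* if it contains all parents of its elements; $E(X)$ is the set of tasks outside $X$ all of whose parents lie in $X$. A *regimen* $\Sigma$ gives for every set of tasks $Z$ a map from the workers to tasks or $\perp$ (idle), with values in $E(Z)\cup\{\perp\}$ if $Z$ is precedence-closed. The game starts with $Y=\emptyset$; in each round every worker $i$ with $\Sigma(Y)(i)=j\neq\perp$ attempts task $j$ and succeeds with probability $p_{i,j}$, all attempts being independent; the tasks on which at least one worker succeeds are added to $Y$. The completion time is the number of rounds until $Y$ contains all sinks of $G$ ($\infty$ if this never happens). ROPAS asks for a regimen of minimum expected completion time. The *width* $w$ of $G$ is the largest cardinality of an antichain (a set of tasks no two of which are joined by a path). **Algorithm OPT.** The *admissible evolution* $\mathcal A$ is the directed graph whose nodes are constructed inductively: $\emptyset$ is a node, and for each node $X$ that does not contain all sinks of $G$ and each nonempty $D\subseteq E(X)$, $X\cup D$ is a node and $(X,X\cup D)$ an arc. OPT constructs the nodes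 of $\mathcal A$ and a topological sort $Y_1,\dots,Y_m$ of them (here: by cardinality), sets $S_{Y_m}=0$ with all workers idle at $Y_m$, and for $h=m-1,\dots,1$ goes through all assignments $A$ of the $n$ workers to tasks in $E(Y_h)$ (no idling). With $a_D$ the probability that under $A$ exactly the tasks in $D$ are executed in a round, it computes $$\frac{1}{1-a_\emptyset}\Bigl(1+\sum_{\emptyset\ne D\subseteq I}a_D\,S_{Y_h\cup D}\Bigr),$$ where $I$ is the set of tasks assigned by $A$ (assignments with $a_\emptyset=1$ count as $\infty$); $S_{Y_h}$ is the minimum of these values, and an assignment attaining it is the value of the regimen $\Sigma_{OPT}$ at $Y_h$. **Theorem.** 1. The nodes of $\mathcal A$ are exactly the precedence-closed sets of tasks, and the list $Y_1,\dots,Y_m$ computed by OPT contains each of them exactly once, with no arc of $\mathcal A$ leading from a later to an earlier node. Moreover $m\le (t+1)^w$, and at each node there are at most $t^n$ assignments to be tried. 2. For every instance, with real or with rational probabilities, $\Sigma_{OPT}$ is a regimen, its expected completion time is finite, and it is at most that of any other regimen. 3. OPT runs in polynomial time when the width and the number of workers are bounded by constants: for all $w_0,n_0$ there is a polynomial $q$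 such that on every instance with $w\le w_0$ and $n\le n_0$ (i) the number of steps is at most $q(t)$, when each arithmetic operation or comparison of real numbers is one step; and (ii) if all $p_{i,j}$ are rational and OPT computes with exact fractions in lowest terms, the cost is at most $q(s)$, where an operation on fractions with $b$ and $b'$ bits costs $(b+b')^2$ steps and $s$ is the size of the instance (number of tasks, workers and arcs plus the total number of bits of the $p_{i,j}$). In both cases a step is an operation on a task, worker, counter or pointer, one access to the input, or an operation on one entry of a bit vector of length $t$ that represents a set of tasks. -/

import Mathlib

open MeasureTheory
open scoped ENNReal

namespace Ropas

/-! ## The problem -/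

/-- An instance of ROPAS: a dag on the tasks `Fin t`, given by its adjacency matrix `arc`, and the
success probabilities `p i j` of worker `i : Fin n` on task `j`; every task can be executed by some
worker with non-zero probability. The numbers live in an ordered field `K` (used with `ℝ`, `ℚ`). -/
structure Problem (K : Type) [Field K] [LinearOrder K] (t n : ℕ) where
  arc : Fin t → Fin t → Bool
  acyclic : ∀ v, ¬ Relation.TransGen (fun a b => arc a b = true) v v
  p : Fin n → Fin t → K
  p_nonneg : ∀ i j, 0 ≤ p i j
  p_le_one : ∀ i j, p i j ≤ 1
  exists_pos : ∀ j, ∃ i, 0 < p i j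

section Model

variable {K : Type} [Field K] [LinearOrder K] {t n : ℕ}

/-- There is a (non-trivial) path from `u` to `v`. -/
def Problem.Path (P : Problem K t n) (u v : Fin t) : Prop :=
  Relation.TransGen (fun a b => P.arc a b = true) u v

open Classical in
/-- The width of the dag: the largest cardinality of an antichain. -/
noncomputable def Problem.width (P : Problem K t n) : ℕ :=
  (Finset.univ.filter fun A : Finset (Fin t) =>
    IsAntichain P.Path (A : Set (Fin t))).sup Finset.card

/-- The set of tasks `X` satisfies precedence constraints. -/
def Problem.Closed (P : Problem K t n) (X : Finset (Fin t)) : Prop :=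
  ∀ j ∈ X, ∀ i, P.arc i j = true → i ∈ X

/-- The set `E(X)` of tasks that are eligible when the tasks in `X` have been executed. -/
def Problem.eligible (P : Problem K t n) (X : Finset (Fin t)) : Finset (Fin t) :=
  Finset.univ.filter fun j => j ∉ X ∧ ∀ i, P.arc i j = true → i ∈ X

/-- The sinks (childless nodes) of the dag. -/
def Problem.sinks (P : Problem K t n) : Finset (Fin t) :=
  Finset.univ.filter fun j => ∀ k, P.arc j k = false

/-- Nodes of the admissible evolution of execution. -/
inductive Problem.Node (P : Problem K t n) : Finset (Fin t) → Prop
  | empty : P.Node ∅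
  | step (X D : Finset (Fin t)) : P.Node X → ¬ P.sinks ⊆ X → D ⊆ P.eligible X → D.Nonempty →
      P.Node (X ∪ D)

/-- Arcs of the admissible evolution of execution. -/
def Problem.Arc (P : Problem K t n) (X Y : Finset (Fin t)) : Prop :=
  P.Node X ∧ ¬ P.sinks ⊆ X ∧ ∃ D, D ⊆ P.eligible X ∧ D.Nonempty ∧ Y = X ∪ D

/-- `Ys` lists all nodes of the admissible evolution of execution, each exactly once, and every arc
leads from a node to a later one. -/
def Problem.IsTopologicalSort (P : Problem K t n) (Ys : List (Finset (Fin t))) : Prop :=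
  Ys.Nodup ∧ (∀ X, X ∈ Ys ↔ P.Node X) ∧ Ys.Pairwise (fun X Y => ¬ P.Arc Y X)

/-- Maps from sets of executed tasks to assignments; `none` is the element `⊥` (idling). -/
abbrev Regimen (t n : ℕ) : Type := Finset (Fin t) → Fin n → Option (Fin t)

/-- A regimen assigns workers to eligible tasks or to `⊥`. -/
def Problem.IsRegimen (P : Problem K t n) (R : Regimen t n) : Prop :=
  ∀ Z, P.Closed Z → ∀ i j, R Z i = some j → j ∈ P.eligible Z

/-! ## The game -/

/-- `ω k (i, j)` tells whether worker `i`, if assigned to task `j` in round `k`, succeeds. -/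
abbrev Outcomes (t n : ℕ) : Type := ℕ → Fin n × Fin t → Bool

/-- The law of the attempts: all of them are independent, and an attempt of worker `i` at task `j`
succeeds with probability `p i j`. -/
noncomputable def Problem.law (P : Problem ℝ t n) : Measure (Outcomes t n) :=
  Measure.infinitePi fun _ : ℕ => Measure.pi fun a : Fin n × Fin t =>
    ProbabilityTheory.bernoulliMeasure true false
      (⟨P.p a.1 a.2, P.p_nonneg a.1 a.2, P.p_le_one a.1 a.2⟩ : unitInterval)

/-- The set `Y` of executed tasks after `k` rounds, starting with `X` already executed. -/
def executed (R : Regimen t n) (X : Finset (Fin t)) (ω : Outcomes t n) : ℕ → Finset (Fin t)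
  | 0 => X
  | k + 1 => executed R X ω k ∪
      Finset.univ.filter fun j => ∃ i, R (executed R X ω k) i = some j ∧ ω k (i, j) = true

/-- Time to completion, starting with `X` already executed: the least number of rounds after which
every sink has been executed (`∞` if there is none). -/
noncomputable def Problem.completionTime (P : Problem K t n) (R : Regimen t n)
    (X : Finset (Fin t)) (ω : Outcomes t n) : ℝ≥0∞ :=
  ⨅ (k : ℕ) (_ : P.sinks ⊆ executed R X ω k), (k : ℝ≥0∞)

/-- Expected completion time of a regimen. -/
noncomputable def Problem.expectedTime (P : Problem ℝ t n) (R : Regimen t n) : ℝ≥0∞ :=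
  ∫⁻ ω, P.completionTime R ∅ ω ∂P.law

/-- `R` is a regimen of minimum expected completion time. -/
def Problem.IsOptimal (P : Problem ℝ t n) (R : Regimen t n) : Prop :=
  P.IsRegimen R ∧ ∀ R', P.IsRegimen R' → P.expectedTime R ≤ P.expectedTime R'

/-- An instance with rational probabilities, seen as an instance with real probabilities. -/
noncomputable def Problem.toReal (P : Problem ℚ t n) : Problem ℝ t n where
  arc := P.arc
  acyclic := P.acyclic
  p i j := (P.p i j : ℝ)
  p_nonneg i j := by exact_mod_cast P.p_nonneg i j
  p_le_one i j := by exact_mod_cast P.p_le_one i j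
  exists_pos j := by
    obtain ⟨i, hi⟩ := P.exists_pos j
    exact ⟨i, by exact_mod_cast hi⟩

end Model

/-! ## Cost model

The algorithm is written in a monad that counts elementary steps. One step is an operation on a
machine word (a task, a worker, a counter, a pointer, an entry of a bit vector, an access to an entry
of the input). A set of tasks is a bit vector of length `t`, and an operation on whole sets pays
for its length. An arithmetic operation or comparison on the numbers `a`, `b` costs `c a b`. -/

/-- A value together with the number of steps spent on computing it. -/
structure Timed (α : Type) where
  val : α
  time : ℕ

instance : Monad Timed where
  pure a := ⟨a, 0⟩
  bind x f := ⟨(f x.val).val, x.time + (f x.val).time⟩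

/-- The value `a`, obtained at the cost of `k` steps. -/
def charge {α : Type} (k : ℕ) (a : α) : Timed α := ⟨a, k⟩

/-- Unit cost of arithmetic. -/
def unitCost (K : Type) : K → K → ℕ := fun _ _ => 1

/-- The number of bits of a fraction in lowest terms. -/
def bits (q : ℚ) : ℕ := Nat.size q.num.natAbs + Nat.size q.den

/-- Bit cost of exact arithmetic with fractions in lowest terms (schoolbook algorithms; reducing
the result is paid for, too). -/
def bitCost : ℚ → ℚ → ℕ := fun a b => (bits a + bits b) ^ 2

/-- The size of an instance with rational probabilities. -/
def Problem.size {t n : ℕ} (P : Problem ℚ t n) : ℕ :=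
  t + n + (Finset.univ.filter fun a : Fin t × Fin t => P.arc a.1 a.2 = true).card +
    ∑ i, ∑ j, bits (P.p i j)

/-! ### Loops over lists -/

/-- The loop that updates a state with each element of a list in turn. -/
def foldT {α β : Type} (f : β → α → Timed β) : β → List α → Timed β
  | b, [] => charge 1 b
  | b, a :: l => do
    let b' ← f b a
    let r ← foldT f b' l
    charge 1 r

def mapT {α β : Type} (f : α → Timed β) : List α → Timed (List β)
  | [] => charge 1 []
  | a :: l => do
    let b ← f a
    let r ← mapT f l
    charge 1 (b :: r)

def filterT {α : Type} (q : α → Timed Bool) : List α → Timed (List α)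
  | [] => charge 1 []
  | a :: l => do
    let b ← q a
    let r ← filterT q l
    charge 1 (if b then a :: r else r)

def allT {α : Type} (q : α → Timed Bool) : List α → Timed Bool
  | [] => charge 1 true
  | a :: l => do
    let b ← q a
    if b then
      let r ← allT q l
      charge 1 r
    else charge 1 false

def appendT {α : Type} (l₁ l₂ : List α) : Timed (List α) :=
  charge (l₁.length + 1) (l₁ ++ l₂)

def reverseT {α : Type} (l : List α) : Timed (List α) :=
  charge (l.length + 1) l.reverse

/-- The list of `0, …, m - 1`. -/
def rangeT (m : ℕ) : Timed (List (Fin m)) :=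
  charge (m + 1) (List.finRange m)

/-- All sublists (the subsets, for a list without repetitions). -/
def sublistsT {α : Type} : List α → Timed (List (List α))
  | [] => charge 1 [[]]
  | a :: l => do
    let r ← sublistsT l
    let s ← mapT (fun x => charge 1 (a :: x)) r
    appendT r s

/-- All maps from `m` workers to the elements of the list `E`. -/
def assignmentsT {α : Type} (E : List α) : (m : ℕ) → Timed (List (Fin m → α))
  | 0 => charge 1 [Fin.elim0]
  | m + 1 => do
    let r ← assignmentsT E m
    foldT (fun acc a => do
      let s ← mapT (fun A => charge (m + 1) (Fin.cons a A : Fin (m + 1) → α)) r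
      appendT s acc) [] E

/-! ### Operations on sets of tasks -/

section Sets

variable {t : ℕ}

def memT (j : Fin t) (X : Finset (Fin t)) : Timed Bool := charge 1 (decide (j ∈ X))

def eqT (X Y : Finset (Fin t)) : Timed Bool := charge (t + 1) (decide (X = Y))

def cardT (X : Finset (Fin t)) : Timed ℕ := charge (t + 1) X.card

def emptyT (t : ℕ) : Timed (Finset (Fin t)) := charge (t + 1) ∅

/-- `X ∪ D`, where `D` is given as a list. -/
def unionT (X : Finset (Fin t)) (D : List (Fin t)) : Timed (Finset (Fin t)) :=
  charge (t + D.length + 1) (X ∪ D.toFinset)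

/-- Linear search in a list of sets. -/
def searchT (X : Finset (Fin t)) : List (Finset (Fin t)) → Timed Bool
  | [] => charge 1 false
  | Z :: l => do
    let b ← eqT X Z
    if b then charge 1 true
    else
      let r ← searchT X l
      charge 1 r

/-- Insertion into a list of sets ordered by cardinality. -/
def insertT (X : Finset (Fin t)) : List (Finset (Fin t)) → Timed (List (Finset (Fin t)))
  | [] => charge 1 [X]
  | Z :: l => do
    let a ← cardT X
    let b ← cardT Z
    if a ≤ b then charge 1 (X :: Z :: l)
    else
      let r ← insertT X l
      charge 1 (Z :: r)

/-- Insertion sort of a list of sets by cardinality. -/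
def sortT (l : List (Finset (Fin t))) : Timed (List (Finset (Fin t))) :=
  foldT (fun acc X => insertT X acc) [] l

end Sets

/-! ## The algorithm OPT -/

section Algorithm

variable {K : Type} [Field K] [LinearOrder K] {t n : ℕ}

/-- Does `X` contain every sink? -/
def Problem.containsSinksT (P : Problem K t n) (X : Finset (Fin t)) : Timed Bool := do
  let ts ← rangeT t
  allT (fun j => do
    let childless ← allT (fun k => charge 1 (!P.arc j k)) ts
    let b ← memT j X
    charge 1 (!childless || b)) ts

/-- The list of the tasks in `E(X)`. -/
def Problem.eligibleT (P : Problem K t n) (X : Finset (Fin t)) : Timed (List (Fin t)) := do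
  let ts ← rangeT t
  filterT (fun j => do
    let parents ← allT (fun i => do
      let b ← memT i X
      charge 1 (!P.arc i j || b)) ts
    let b ← memT j X
    charge 1 (!b && parents)) ts

/-- The children of the node `X` of the admissible evolution of execution. -/
def Problem.childrenT (P : Problem K t n) (X : Finset (Fin t)) :
    Timed (List (Finset (Fin t))) := do
  let finished ← P.containsSinksT X
  if finished then charge 1 []
  else
    let E ← P.eligibleT X
    let Ds ← sublistsT E
    let Ds' ← filterT (fun D => charge 1 (!D.isEmpty)) Ds
    mapT (fun D => unionT X D) Ds'

/-- `k` rounds of the inductive construction of the nodes; `frontier` holds the nodes that were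
added in the preceding round. -/
def Problem.growT (P : Problem K t n) :
    ℕ → List (Finset (Fin t)) → List (Finset (Fin t)) → Timed (List (Finset (Fin t)))
  | 0, nodes, _ => charge 1 nodes
  | k + 1, nodes, frontier => do
    let r ← foldT (fun st X => do
      let Ys ← P.childrenT X
      foldT (fun (st : List (Finset (Fin t)) × List (Finset (Fin t))) Y => do
        let known ← searchT Y st.1
        if known then charge 1 st
        else charge 1 (Y :: st.1, Y :: st.2)) st Ys) (nodes, []) frontier
    let nodes' ← P.growT k r.1 r.2
    charge 1 nodes'

/-- A topological sort of the admissible evolution of execution. Each arc adds a task, so that `t`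
rounds find all nodes and sorting by cardinality is a topological sort. -/
def Problem.topologicalSortT (P : Problem K t n) : Timed (List (Finset (Fin t))) := do
  let X ← emptyT t
  let nodes ← P.growT t [X] [X]
  sortT nodes

/-- The assignments of the workers to tasks of `E(Y)` that are tried at the node `Y`. -/
def Problem.candidatesT (P : Problem K t n) (Y : Finset (Fin t)) :
    Timed (List (Fin n → Fin t)) := do
  let E ← P.eligibleT Y
  assignmentsT E n

/-- The tasks to which `A` assigns workers, without repetitions. -/
def assignedT (A : Fin n → Fin t) : Timed (List (Fin t)) := do
  let ws ← rangeT n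
  foldT (fun acc i => charge (acc.length + 1) (if A i ∈ acc then acc else A i :: acc)) [] ws

/-- The dictionary that maps the nodes processed so far to the values `S` and the assignments. -/
abbrev Table (K : Type) (t n : ℕ) : Type :=
  List (Finset (Fin t) × K × (Fin n → Option (Fin t)))

/-- Reading `S_X` from the dictionary. (All entries that are read are present; `0` is a dummy.) -/
def lookupT (X : Finset (Fin t)) : Table K t n → Timed K
  | [] => charge 1 0
  | e :: l => do
    let b ← eqT X e.1
    if b then charge 1 e.2.1
    else
      let r ← lookupT X l
      charge 1 r

/- In the rest of this section `c` is the cost of arithmetic. -/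

/-- The probability that every worker assigned by `A` to task `j` fails. -/
def Problem.failT (P : Problem K t n) (c : K → K → ℕ) (A : Fin n → Fin t) (j : Fin t) :
    Timed K := do
  let ws ← rangeT n
  foldT (fun x i =>
    if A i = j then do
      let f ← charge (1 + c 1 (P.p i j)) (1 - P.p i j)
      charge (c x f) (x * f)
    else charge 1 x) 1 ws

/-- The probability that `A` executes exactly the tasks in `D`, where `I` lists the assigned tasks
and `D` is a sublist of `I`. -/
def Problem.probT (P : Problem K t n) (c : K → K → ℕ) (A : Fin n → Fin t) (I D : List (Fin t)) :
    Timed K :=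
  foldT (fun x j => do
    let f ← P.failT c A j
    let inD ← charge (D.length + 1) (decide (j ∈ D))
    if inD then
      let s ← charge (c 1 f) (1 - f)
      charge (c x s) (x * s)
    else charge (c x f) (x * f)) 1 I

/-- The sum of `Pr[A executes exactly D] * S_{Y ∪ D}` over the nonempty subsets `D` of the set of
assigned tasks `I`. -/
def Problem.sumT (P : Problem K t n) (c : K → K → ℕ) (S : Table K t n) (Y : Finset (Fin t))
    (A : Fin n → Fin t) (I : List (Fin t)) : Timed K := do
  let Ds ← sublistsT I
  foldT (fun sum D =>
    if D.isEmpty then charge 1 sum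
    else do
      let a ← P.probT c A I D
      let Z ← unionT Y D
      let s ← lookupT Z S
      let x ← charge (c a s) (a * s)
      charge (c sum x) (sum + x)) 0 Ds

/-- Processing one candidate assignment `A` at the node `Y`; `best` holds the current minimum and
the assignment that achieves it, and `none` stands for the minimum `∞`. Since `1 / 0 = ∞`, an
assignment that surely executes nothing does not improve the minimum. -/
def Problem.tryT (P : Problem K t n) (c : K → K → ℕ) (S : Table K t n) (Y : Finset (Fin t))
    (best : Option (K × (Fin n → Fin t))) (A : Fin n → Fin t) :
    Timed (Option (K × (Fin n → Fin t))) := do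
  let I ← assignedT A
  let sum ← P.sumT c S Y A I
  let a ← P.probT c A I []
  let d ← charge (c 1 a) (1 - a)
  let isZero ← charge (c d 0) (decide (d = 0))
  if isZero then charge 1 best
  else
    let u ← charge (c 1 sum) (1 + sum)
    let v ← charge (c u d) (u / d)
    match best with
    | none => charge 1 (some (v, A))
    | some b => charge (c v b.1) (if v < b.1 then some (v, A) else some b)

/-- Processing the node `Y`: its minimum and a best assignment are added to the dictionary. -/
def Problem.processT (P : Problem K t n) (c : K → K → ℕ) (S : Table K t n)
    (Y : Finset (Fin t)) : Timed (Table K t n) := do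
  let As ← P.candidatesT Y
  let best ← foldT (fun best A => P.tryT c S Y best A) none As
  match best with
  | none => charge 1 S
  | some b => charge (n + 1) ((Y, b.1, fun i => some (b.2 i)) :: S)

/-- The algorithm OPT: computes a topological sort `Y₁, …, Yₘ` of the admissible evolution of
execution, puts `S_{Yₘ} = 0` with all workers idle, and processes `Yₘ₋₁, …, Y₁`. -/
def Problem.optT (P : Problem K t n) (c : K → K → ℕ) : Timed (Table K t n) := do
  let Ys ← P.topologicalSortT
  let Zs ← reverseT Ys
  match Zs with
  | [] => charge 1 []
  | Ym :: rest => do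
    let S ← charge (n + 1) [(Ym, 0, fun _ => none)]
    foldT (fun S Y => P.processT c S Y) S rest

/-- The regimen described by a dictionary (workers idle at sets that are not in it). -/
def Table.regimen (S : Table K t n) : Regimen t n := fun Z i =>
  match S.find? (fun e => decide (e.1 = Z)) with
  | none => none
  | some e => e.2.2 i

/-- The regimen found by OPT. -/
def Problem.optRegimen (P : Problem K t n) (c : K → K → ℕ) : Regimen t n :=
  Table.regimen (P.optT c).val

end Algorithm

end Ropas

namespace Ropas

/-! ## Timed computations -/

section Timed

variable {α β : Type}

/-! The nodes of the admissible evolution are the precedence-closed sets, since a closed set can be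
dismantled by removing maximal tasks one at a time. A closed set is determined by its maximal tasks,
which form an antichain, so there are at most `(t + 1) ^ w` of them. Likewise each `E(X)` is an
antichain, so a node has at most `2 ^ w` children.

Optimality. `Solves R S` says that `S` satisfies the Bellman equation with the minimum taken over
non-idling assignments only, and that `R` attains it while making progress with positive
probability. OPT produces such a pair (`solves_optRegimen`): solving `v = 1 + a_∅ v + ∑ a_D S_{Y ∪
D}` for `v` gives the formula that it evaluates, and nodes processed later have at most the
cardinality of those processed before, so that they do not disturb equations already established.
The point that needs an argument is that idling never helps. This is proved together with the
antitonicity of `S` (`Solves.antitone_and_le`), because each statement at a set uses the other at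
larger sets.

The expected completion time is the sum over `k` of the probability that some sink is missing after
`k` rounds, and these probabilities satisfy a one-step recursion, because the law of the attempts is
invariant under splitting off the first round. The recursion bounds the time of `R` by `S ∅`
(`Solves.expectedTime_le`) and the time of every regimen from below by `S ∅`
(`Solves.le_tsum_unfinished`).

Running time. For constant `w` and `n`, the numbers of nodes, candidates and subsets are polynomial,
which settles unit cost. For bit cost the danger is that fractions grow from node to node. If `B` is
a common denominator of the probabilities, then every `a_D` has denominator `Q = B ^ (n * n + 1)`.
Suppose that all stored values have the common denominator `M`. The numerator of the new value is a
fraction over `Q * M`, and `1 - a_∅ = l / Q` with `l ≤ Q`; the quotient has denominator `M * l`. So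
each node multiplies the common denominator by at most `Q`, and the number of bits grows only
linearly in the number of nodes (`processT_bound`). The structure `Sizes` treats both cost models at
once. -/

@[simp] theorem val_bind (x : Timed α) (f : α → Timed β) : (x >>= f).val = (f x.val).val := rfl

@[simp] theorem time_bind (x : Timed α) (f : α → Timed β) :
    (x >>= f).time = x.time + (f x.val).time := rfl

@[simp] theorem val_charge (k : ℕ) (a : α) : (charge k a).val = a := rfl

@[simp] theorem time_charge (k : ℕ) (a : α) : (charge k a).time = k := rfl

@[simp] theorem val_foldT (f : β → α → Timed β) (b : β) (l : List α) :
    (foldT f b l).val = l.foldl (fun b a => (f b a).val) b := by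
  induction l generalizing b with
  | nil => rfl
  | cons a l ih => simp [foldT, ih]

@[simp] theorem val_mapT (f : α → Timed β) (l : List α) :
    (mapT f l).val = l.map fun a => (f a).val := by
  induction l with
  | nil => rfl
  | cons a l ih => simp [mapT, ih]

@[simp] theorem val_filterT (q : α → Timed Bool) (l : List α) :
    (filterT q l).val = l.filter fun a => (q a).val := by
  induction l with
  | nil => rfl
  | cons a l ih => simp [filterT, ih, List.filter_cons]

@[simp] theorem val_allT (q : α → Timed Bool) (l : List α) :
    (allT q l).val = l.all fun a => (q a).val := by
  induction l with
  | nil => rfl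
  | cons a l ih => by_cases h : (q a).val <;> simp [allT, ih, h]

@[simp] theorem val_appendT (l₁ l₂ : List α) : (appendT l₁ l₂).val = l₁ ++ l₂ := rfl

@[simp] theorem time_appendT (l₁ l₂ : List α) : (appendT l₁ l₂).time = l₁.length + 1 := rfl

@[simp] theorem val_reverseT (l : List α) : (reverseT l).val = l.reverse := rfl

@[simp] theorem time_reverseT (l : List α) : (reverseT l).time = l.length + 1 := rfl

@[simp] theorem val_rangeT (m : ℕ) : (rangeT m).val = List.finRange m := rfl

@[simp] theorem time_rangeT (m : ℕ) : (rangeT m).time = m + 1 := rfl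

@[simp] theorem val_sublistsT (l : List α) : (sublistsT l).val = l.sublists' := by
  induction l with
  | nil => rfl
  | cons a l ih => simp [sublistsT, ih]

/-- The invariant depends on the number of iterations, because the bounds on lengths and on numbers
grow during a loop. It is available when the time of an iteration is estimated. -/
theorem foldT_bound {f : β → α → Timed β} {T : ℕ} (Inv : ℕ → β → Prop) (l : List α) (b : β) (k : ℕ)
    (hb : Inv k b)
    (hstep : ∀ i b a, k ≤ i → i < k + l.length → a ∈ l → Inv i b →
      (f b a).time ≤ T ∧ Inv (i + 1) (f b a).val) :
    (foldT f b l).time ≤ l.length * (T + 1) + 1 ∧ Inv (k + l.length) (foldT f b l).val := by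
  induction l generalizing b k with
  | nil => simpa [foldT] using hb
  | cons a l ih =>
    obtain ⟨h1, h2⟩ := hstep k b a le_rfl (by simp) (by simp) hb
    obtain ⟨h3, h4⟩ := ih (f b a).val (k + 1) h2 fun i b a' hi hi' ha =>
      hstep i b a' (by omega) (by simp; omega) (by simp [ha])
    refine ⟨?_, ?_⟩
    · simp only [foldT, time_bind, time_charge, List.length_cons, Nat.succ_mul]
      linarith
    · simpa [foldT, add_assoc, add_comm 1] using h4

theorem foldT_time_le {f : β → α → Timed β} {T : ℕ} (l : List α) (b : β)
    (h : ∀ b, ∀ a ∈ l, (f b a).time ≤ T) : (foldT f b l).time ≤ l.length * (T + 1) + 1 :=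
  (foldT_bound (fun _ _ => True) l b 0 trivial fun _ b a _ _ ha _ => ⟨h b a ha, trivial⟩).1

theorem mapT_time_le {f : α → Timed β} {T : ℕ} (l : List α) (h : ∀ a ∈ l, (f a).time ≤ T) :
    (mapT f l).time ≤ l.length * (T + 1) + 1 := by
  induction l with
  | nil => simp [mapT]
  | cons a l ih =>
    have h1 := h a (by simp)
    have h2 := ih fun a ha => h a (by simp [ha])
    simp only [mapT, time_bind, time_charge, List.length_cons, Nat.succ_mul]
    linarith

theorem filterT_time_le {q : α → Timed Bool} {T : ℕ} (l : List α) (h : ∀ a ∈ l, (q a).time ≤ T) :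
    (filterT q l).time ≤ l.length * (T + 1) + 1 := by
  induction l with
  | nil => simp [filterT]
  | cons a l ih =>
    have h1 := h a (by simp)
    have h2 := ih fun a ha => h a (by simp [ha])
    simp only [filterT, time_bind, time_charge, List.length_cons, Nat.succ_mul]
    linarith

theorem allT_time_le {q : α → Timed Bool} {T : ℕ} (l : List α) (h : ∀ a ∈ l, (q a).time ≤ T) :
    (allT q l).time ≤ l.length * (T + 1) + 1 := by
  induction l with
  | nil => simp [allT]
  | cons a l ih =>
    have h1 := h a (by simp)
    have h2 := ih fun a ha => h a (by simp [ha])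
    simp only [allT, time_bind, List.length_cons, Nat.succ_mul]
    split_ifs
    · simp only [time_bind, time_charge]
      linarith
    · simp only [time_charge]
      linarith [Nat.zero_le (l.length * (T + 1))]

/-! ### Assignments -/

theorem foldl_append_length {γ : Type} (g : α → List γ) (k : ℕ) (hg : ∀ a, (g a).length = k)
    (E : List α) (acc : List γ) :
    (E.foldl (fun acc a => g a ++ acc) acc).length = E.length * k + acc.length := by
  induction E generalizing acc with
  | nil => simp
  | cons a E ih =>
    rw [List.foldl_cons, ih, List.length_append, hg, List.length_cons]
    ring

theorem mem_foldl_append {γ : Type} (g : α → List γ) (E : List α) (acc : List γ) (x : γ) :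
    x ∈ E.foldl (fun acc a => g a ++ acc) acc ↔ (∃ a ∈ E, x ∈ g a) ∨ x ∈ acc := by
  induction E generalizing acc with
  | nil => simp
  | cons a E ih =>
    rw [List.foldl_cons, ih, List.mem_append, List.exists_mem_cons_iff, or_left_comm, or_assoc]

theorem val_assignmentsT_succ (E : List α) (m : ℕ) :
    (assignmentsT E (m + 1)).val =
      E.foldl (fun acc a => ((assignmentsT E m).val.map fun A => Fin.cons a A) ++ acc) [] := by
  simp [assignmentsT]

theorem length_assignmentsT (E : List α) (m : ℕ) :
    (assignmentsT E m).val.length = E.length ^ m := by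
  induction m with
  | zero => simp [assignmentsT]
  | succ m ih =>
    rw [val_assignmentsT_succ, foldl_append_length _ (E.length ^ m) (by simp [ih])]
    simp [pow_succ']

theorem mem_assignmentsT (E : List α) {m : ℕ} (A : Fin m → α) :
    A ∈ (assignmentsT E m).val ↔ ∀ i, A i ∈ E := by
  induction m with
  | zero => simp [assignmentsT, Subsingleton.elim A Fin.elim0]
  | succ m ih =>
    rw [val_assignmentsT_succ, mem_foldl_append]
    simp only [List.mem_map, List.not_mem_nil, or_false, Fin.forall_fin_succ]
    constructor
    · rintro ⟨a, ha, A', hA', rfl⟩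
      exact ⟨by simpa using ha, by simpa using (ih A').1 hA'⟩
    · rintro ⟨h0, h⟩
      exact ⟨A 0, h0, Fin.tail A, (ih _).2 h, by simp⟩

/-- Every level of the recursion is charged as much as the last one. The base `e + 1` instead of `e`
keeps the power monotone in the exponent even for `e = 0`. -/
theorem assignmentsT_time_le (E : List α) {m e : ℕ} (he : E.length ≤ e) :
    (assignmentsT E m).time ≤ m * (e * ((e + 1) ^ m * (m + 3) + 3) + 1) + 1 := by
  induction m with
  | zero => simp [assignmentsT]
  | succ m ih =>
    have hlen : (assignmentsT E m).val.length ≤ (e + 1) ^ m := by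
      rw [length_assignmentsT]
      exact Nat.pow_le_pow_left (by omega) m
    have hfold := foldT_time_le (T := (e + 1) ^ m * (m + 3) + 2) (f := fun acc a => do
      let s ← mapT (fun A => charge (m + 1) (Fin.cons a A : Fin (m + 1) → α))
        (assignmentsT E m).val
      appendT s acc) E [] fun acc a _ => by
        have h := mapT_time_le (T := m + 1)
          (f := fun A => charge (m + 1) (Fin.cons a A : Fin (m + 1) → α))
          (assignmentsT E m).val (by simp)
        simp only [time_bind, time_appendT, val_mapT, List.length_map]
        calc _ ≤ (assignmentsT E m).val.length * (m + 3) + 2 := by linarith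
          _ ≤ _ := by gcongr
    simp only [assignmentsT, time_bind]
    calc _ ≤ (m * (e * ((e + 1) ^ m * (m + 3) + 3) + 1) + 1) +
          (E.length * ((e + 1) ^ m * (m + 3) + 2 + 1) + 1) := Nat.add_le_add ih hfold
      _ ≤ (m * (e * ((e + 1) ^ m * (m + 3) + 3) + 1) + 1) +
          (e * ((e + 1) ^ m * (m + 3) + 3) + 1) := by gcongr
      _ = (m + 1) * (e * ((e + 1) ^ m * (m + 3) + 3) + 1) + 1 := by ring
      _ ≤ _ := by gcongr <;> omega

end Timed

/-! ## Precedence-closed sets -/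

section Graph

variable {K : Type} [Field K] [LinearOrder K] {t n : ℕ} {P : Problem K t n} {X Y D : Finset (Fin t)}

theorem Problem.mem_eligible {j : Fin t} :
    j ∈ P.eligible X ↔ j ∉ X ∧ ∀ i, P.arc i j = true → i ∈ X := by
  simp [Problem.eligible]

instance Problem.path_isStrictOrder (P : Problem K t n) : IsStrictOrder (Fin t) P.Path where
  irrefl := P.acyclic
  trans _ _ _ := Relation.TransGen.trans

theorem Problem.wellFounded_path (P : Problem K t n) : WellFounded P.Path :=
  Finite.wellFounded_of_trans_of_irrefl _

theorem Problem.wellFounded_path_swap (P : Problem K t n) :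
    WellFounded (Function.swap P.Path) :=
  Finite.wellFounded_of_trans_of_irrefl _

theorem Problem.Closed.mem_of_path (hX : P.Closed X) {u v : Fin t} (h : P.Path u v) (hv : v ∈ X) :
    u ∈ X := by
  induction h using Relation.TransGen.head_induction_on with
  | single h => exact hX _ hv _ h
  | head h _ ih => exact hX _ ih _ h

theorem Problem.closed_empty (P : Problem K t n) : P.Closed ∅ := by
  simp [Problem.Closed]

theorem Problem.Closed.union (hX : P.Closed X) (hD : D ⊆ P.eligible X) : P.Closed (X ∪ D) := by
  intro j hj i hij
  rcases Finset.mem_union.1 hj with h | h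
  · exact Finset.mem_union_left _ (hX j h i hij)
  · exact Finset.mem_union_left _ ((Problem.mem_eligible.1 (hD h)).2 i hij)

/-- A maximal task outside a closed set is a sink, since its children would lie outside as well.
Hence the game ends exactly at the full set. -/
theorem Problem.Closed.sinks_subset_iff (hX : P.Closed X) : P.sinks ⊆ X ↔ X = Finset.univ := by
  refine ⟨fun h => ?_, fun h => by simp [h]⟩
  by_contra hne
  obtain ⟨v, hv, hmax⟩ := P.wellFounded_path_swap.has_min {v | v ∉ X} (by
    simpa [Set.Nonempty, Finset.eq_univ_iff_forall] using hne)
  refine hv (h ?_)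
  simp only [Problem.sinks, Finset.mem_filter, Finset.mem_univ, true_and]
  intro k
  by_contra hk
  have hk : P.arc v k = true := by simpa using hk
  exact hmax k (fun hkX => hv (hX k hkX v hk)) (Relation.TransGen.single hk)

theorem Problem.exists_eligible (P : Problem K t n) (hX : X ≠ Finset.univ) :
    ∃ j, j ∈ P.eligible X := by
  obtain ⟨v, hv, hmin⟩ := P.wellFounded_path.has_min {v | v ∉ X} (by
    simpa [Set.Nonempty, Finset.eq_univ_iff_forall] using hX)
  refine ⟨v, Problem.mem_eligible.2 ⟨hv, fun i hi => ?_⟩⟩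
  by_contra hiX
  exact hmin i hiX (Relation.TransGen.single hi)

theorem Problem.Node.closed (h : P.Node X) : P.Closed X := by
  induction h with
  | empty => exact P.closed_empty
  | step X D _ _ hD _ ih => exact ih.union hD

/-- Removing a maximal task `v` from `X` leaves a closed set at which `v` is eligible. -/
theorem Problem.Closed.node (hX : P.Closed X) : P.Node X := by
  induction hm : X.card generalizing X with
  | zero =>
    rw [Finset.card_eq_zero.1 hm]
    exact .empty
  | succ m ih =>
    obtain ⟨v, hv, hmax⟩ := P.wellFounded_path_swap.has_min (X : Set (Fin t)) (by
      simpa using Finset.card_pos.1 (by omega))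
    have hcl : P.Closed (X.erase v) := by
      intro j hj i hij
      rw [Finset.mem_erase] at hj ⊢
      refine ⟨?_, hX j hj.2 i hij⟩
      rintro rfl
      exact hmax j hj.2 (Relation.TransGen.single hij)
    have hel : v ∈ P.eligible (X.erase v) := by
      refine Problem.mem_eligible.2 ⟨by simp, fun i hi => Finset.mem_erase.2 ⟨?_, hX v hv i hi⟩⟩
      rintro rfl
      exact P.acyclic i (Relation.TransGen.single hi)
    have := Problem.Node.step (X.erase v) {v} (ih hcl (by
        rw [Finset.card_erase_of_mem hv, hm]; rfl))
      (fun h => by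
        have := hcl.sinks_subset_iff.1 h
        exact Finset.notMem_erase v X (this ▸ Finset.mem_univ v))
      (by simpa using hel) (by simp)
    rwa [Finset.union_comm, ← Finset.insert_eq, Finset.insert_erase hv] at this

theorem Problem.node_iff_closed (P : Problem K t n) (X : Finset (Fin t)) :
    P.Node X ↔ P.Closed X :=
  ⟨Problem.Node.closed, Problem.Closed.node⟩

/-! ### Width -/

theorem Problem.card_le_width {A : Finset (Fin t)} (hA : IsAntichain P.Path (A : Set (Fin t))) :
    A.card ≤ P.width := by
  classical
  exact Finset.le_sup (f := Finset.card) (by simpa using hA)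

/-- On a path from `u` to an eligible `v`, the last task before `v` lies in `X`, hence so does `u`;
thus `E(X)` is an antichain. -/
theorem Problem.card_eligible_le_width (P : Problem K t n) (hX : P.Closed X) :
    (P.eligible X).card ≤ P.width := by
  refine P.card_le_width fun u hu v hv _ huv => ?_
  rw [Finset.mem_coe, Problem.mem_eligible] at hu hv
  obtain ⟨w, hw, hwv⟩ := Relation.TransGen.tail'_iff.1 huv
  have hwX := hv.2 w hwv
  rcases Relation.reflTransGen_iff_eq_or_transGen.1 hw with rfl | h
  · exact hu.1 hwX
  · exact hu.1 (hX.mem_of_path h hwX)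

open Classical in
/-- The set of all tasks that are equal to or precede one of the tasks `g i`. -/
noncomputable def Problem.downClosure (P : Problem K t n) {w : ℕ} (g : Fin w → Option (Fin t)) :
    Finset (Fin t) :=
  Finset.univ.filter fun u => ∃ i, ∃ v ∈ g i, u = v ∨ P.Path u v

/-- The maximal tasks of `X` form an antichain that generates `X`. They are enumerated by `Fin
P.width`, and `none` fills the unused places; counting such maps yields the bound `(t + 1) ^ w`. -/
theorem Problem.Closed.exists_downClosure_eq (hX : P.Closed X) :
    ∃ g : Fin P.width → Option (Fin t), P.downClosure g = X := by
  classical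
  set A := X.filter fun v => ∀ u ∈ X, ¬ P.Path v u with hA
  have hcard : A.card ≤ P.width := P.card_le_width fun u hu v hv _ huv => by
    simp only [hA, Finset.coe_filter, Set.mem_ofPred_eq] at hu hv
    exact hu.2 v hv.1 huv
  refine ⟨fun i => if h : i.1 < A.card then some (A.equivFin.symm ⟨i, h⟩).1 else none, ?_⟩
  ext u
  simp only [Problem.downClosure, Finset.mem_filter, Finset.mem_univ, true_and]
  constructor
  · rintro ⟨i, v, hv, huv⟩
    split_ifs at hv with h
    · have hvA : v ∈ A := by
        rw [Option.mem_some_iff] at hv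
        rw [← hv]
        exact (A.equivFin.symm ⟨i, h⟩).2
      have hvX : v ∈ X := (Finset.mem_filter.1 hvA).1
      rcases huv with rfl | huv
      · exact hvX
      · exact hX.mem_of_path huv hvX
    · simp at hv
  · intro hu
    obtain ⟨v, ⟨hvX, huv⟩, hmax⟩ := P.wellFounded_path_swap.has_min
      {v | v ∈ X ∧ (u = v ∨ P.Path u v)} ⟨u, hu, .inl rfl⟩
    have hvA : v ∈ A := by
      refine Finset.mem_filter.2 ⟨hvX, fun x hx hvx => hmax x ⟨hx, .inr ?_⟩ hvx⟩
      rcases huv with rfl | huv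
      · exact hvx
      · exact Relation.TransGen.trans huv hvx
    have hlt := (A.equivFin ⟨v, hvA⟩).2
    refine ⟨⟨A.equivFin ⟨v, hvA⟩, hlt.trans_le hcard⟩, v, ?_, huv⟩
    simp

theorem Problem.length_le_of_closed (P : Problem K t n) (l : List (Finset (Fin t)))
    (hl : l.Nodup) (h : ∀ X ∈ l, P.Closed X) : l.length ≤ (t + 1) ^ P.width := by
  classical
  rw [← List.toFinset_card_of_nodup hl]
  calc l.toFinset.card ≤ (Finset.univ.image
        (P.downClosure : (Fin P.width → Option (Fin t)) → Finset (Fin t))).card := by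
        refine Finset.card_le_card fun X hX => ?_
        obtain ⟨g, hg⟩ := (h X (List.mem_toFinset.1 hX)).exists_downClosure_eq
        exact Finset.mem_image.2 ⟨g, Finset.mem_univ _, hg⟩
    _ ≤ _ := Finset.card_image_le
    _ = _ := by simp

end Graph

/-! ## Correctness of the topological sort -/

section SortByCard

variable {t : ℕ}

@[simp] theorem val_memT (j : Fin t) (X : Finset (Fin t)) : (memT j X).val = decide (j ∈ X) := rfl
@[simp] theorem time_memT (j : Fin t) (X : Finset (Fin t)) : (memT j X).time = 1 := rfl
@[simp] theorem val_eqT (X Y : Finset (Fin t)) : (eqT X Y).val = decide (X = Y) := rfl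
@[simp] theorem time_eqT (X Y : Finset (Fin t)) : (eqT X Y).time = t + 1 := rfl
@[simp] theorem val_cardT (X : Finset (Fin t)) : (cardT X).val = X.card := rfl
@[simp] theorem time_cardT (X : Finset (Fin t)) : (cardT X).time = t + 1 := rfl
@[simp] theorem val_unionT (X : Finset (Fin t)) (D : List (Fin t)) :
    (unionT X D).val = X ∪ D.toFinset := rfl
@[simp] theorem time_unionT (X : Finset (Fin t)) (D : List (Fin t)) :
    (unionT X D).time = t + D.length + 1 := rfl

@[simp] theorem val_searchT (X : Finset (Fin t)) (l : List (Finset (Fin t))) :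
    (searchT X l).val = decide (X ∈ l) := by
  induction l with
  | nil => simp [searchT]
  | cons Z l ih => by_cases h : X = Z <;> simp [searchT, h, ih]

theorem val_insertT_perm (X : Finset (Fin t)) (l : List (Finset (Fin t))) :
    (insertT X l).val.Perm (X :: l) := by
  induction l with
  | nil => simp [insertT]
  | cons Z l ih =>
    by_cases h : X.card ≤ Z.card
    · simp [insertT, h]
    · simpa [insertT, h] using (ih.cons Z).trans (.swap X Z l)

theorem pairwise_insertT {X : Finset (Fin t)} {l : List (Finset (Fin t))}
    (h : l.Pairwise fun X Y => X.card ≤ Y.card) :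
    (insertT X l).val.Pairwise fun X Y => X.card ≤ Y.card := by
  induction l with
  | nil => simp [insertT]
  | cons Z l ih =>
    rw [List.pairwise_cons] at h
    by_cases hXZ : X.card ≤ Z.card
    · simp only [insertT, val_bind, val_cardT, hXZ, if_true, val_charge, List.pairwise_cons, List.mem_cons]
      refine ⟨?_, h.1, h.2⟩
      rintro Y (rfl | hY)
      · exact hXZ
      · exact hXZ.trans (h.1 Y hY)
    · simp only [insertT, val_bind, val_cardT, hXZ, if_false, val_charge, List.pairwise_cons]
      refine ⟨fun Y hY => ?_, ih h.2⟩
      rcases List.mem_cons.1 ((val_insertT_perm X l).mem_iff.1 hY) with rfl | hY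
      · omega
      · exact h.1 Y hY

theorem val_sortT_perm (l : List (Finset (Fin t))) : (sortT l).val.Perm l := by
  have key : ∀ acc : List (Finset (Fin t)),
      (l.foldl (fun acc X => (insertT X acc).val) acc).Perm (l ++ acc) := by
    induction l with
    | nil => simp
    | cons X l ih =>
      intro acc
      rw [List.foldl_cons, List.cons_append]
      exact (ih _).trans (((val_insertT_perm X acc).append_left l).trans List.perm_middle)
  simpa [sortT] using key []

theorem pairwise_sortT (l : List (Finset (Fin t))) :
    (sortT l).val.Pairwise fun X Y => X.card ≤ Y.card := by
  have key : ∀ acc : List (Finset (Fin t)), (acc.Pairwise fun X Y => X.card ≤ Y.card) →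
      (l.foldl (fun acc X => (insertT X acc).val) acc).Pairwise fun X Y => X.card ≤ Y.card := by
    induction l with
    | nil => simp
    | cons X l ih => exact fun acc hacc => ih _ (pairwise_insertT hacc)
  simpa [sortT] using key [] List.Pairwise.nil

end SortByCard

/-! ### Construction of the nodes of the admissible evolution -/

section Nodes

variable {K : Type} [Field K] [LinearOrder K] {t n : ℕ} {P : Problem K t n} {X Y D : Finset (Fin t)}

@[simp] theorem Problem.val_containsSinksT (P : Problem K t n) (X : Finset (Fin t)) :
    (P.containsSinksT X).val = decide (P.sinks ⊆ X) := by
  rw [Bool.eq_iff_iff]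
  simp only [Problem.containsSinksT, val_bind, val_rangeT, val_allT, val_charge, val_memT,
    List.all_eq_true, List.mem_finRange, true_imp_iff, Bool.or_eq_true, Bool.not_eq_true',
    decide_eq_true_eq, Finset.subset_iff, Problem.sinks, Finset.mem_filter, Finset.mem_univ,
    true_and, List.all_eq_false]
  refine forall_congr' fun j => ?_
  by_cases h : ∀ k, P.arc j k = false <;> simp_all

theorem Problem.mem_eligibleT {j : Fin t} : j ∈ (P.eligibleT X).val ↔ j ∈ P.eligible X := by
  rw [Problem.mem_eligible]
  simp only [Problem.eligibleT, val_bind, val_rangeT, val_filterT, val_allT, val_charge, val_memT,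
    List.mem_filter, List.mem_finRange, true_and, Bool.and_eq_true, Bool.not_eq_true',
    decide_eq_false_iff_not, List.all_eq_true, true_imp_iff, Bool.or_eq_true, decide_eq_true_eq]
  refine and_congr_right fun _ => forall_congr' fun i => ?_
  cases P.arc i j <;> simp

theorem Problem.nodup_eligibleT (P : Problem K t n) (X : Finset (Fin t)) :
    (P.eligibleT X).val.Nodup := by
  simp only [Problem.eligibleT, val_bind, val_filterT, val_rangeT]
  exact (List.nodup_finRange t).filter _

theorem Problem.length_eligibleT (P : Problem K t n) (X : Finset (Fin t)) :
    (P.eligibleT X).val.length = (P.eligible X).card := by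
  rw [← List.toFinset_card_of_nodup (P.nodup_eligibleT X)]
  congr 1
  ext j
  simp [Problem.mem_eligibleT]

/-- There is an arc of the admissible evolution from `X` to `Y` if `X` is a node. -/
def Problem.Child (P : Problem K t n) (X Y : Finset (Fin t)) : Prop :=
  ¬ P.sinks ⊆ X ∧ ∃ D, D ⊆ P.eligible X ∧ D.Nonempty ∧ Y = X ∪ D

theorem Problem.Child.closed (h : P.Child X Y) (hX : P.Closed X) : P.Closed Y := by
  obtain ⟨_, D, hD, _, rfl⟩ := h
  exact hX.union hD

theorem Problem.card_lt_card_union (hD : D ⊆ P.eligible X) (h : D.Nonempty) :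
    X.card < (X ∪ D).card := by
  obtain ⟨j, hj⟩ := h
  exact Finset.card_lt_card (Finset.ssubset_iff_of_subset Finset.subset_union_left |>.2
    ⟨j, Finset.mem_union_right _ hj, (Problem.mem_eligible.1 (hD hj)).1⟩)

theorem Problem.Child.card_lt (h : P.Child X Y) : X.card < Y.card := by
  obtain ⟨_, D, hD, hne, rfl⟩ := h
  exact Problem.card_lt_card_union hD hne

theorem exists_sublist_toFinset_eq {α : Type} [DecidableEq α] (l : List α) (D : Finset α)
    (h : ∀ a ∈ D, a ∈ l) : ∃ l' : List α, l'.Sublist l ∧ l'.toFinset = D := by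
  refine ⟨l.filter (· ∈ D), List.filter_sublist, ?_⟩
  ext a
  simpa using h a

theorem Problem.mem_childrenT : Y ∈ (P.childrenT X).val ↔ P.Child X Y := by
  simp only [Problem.childrenT, val_bind, Problem.val_containsSinksT, decide_eq_true_eq,
    Problem.Child]
  split_ifs with h
  · simp [h]
  · simp only [val_bind, val_mapT, val_filterT, val_sublistsT, val_charge, val_unionT,
      List.mem_map, List.mem_filter, List.mem_sublists', h, not_false_eq_true, true_and]
    constructor
    · rintro ⟨D, ⟨hD, hne⟩, rfl⟩
      refine ⟨D.toFinset, fun j hj => Problem.mem_eligibleT.1 (hD.subset (List.mem_toFinset.1 hj)),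
        ?_, rfl⟩
      rw [List.toFinset_nonempty_iff]
      simpa using hne
    · rintro ⟨D, hD, hne, rfl⟩
      obtain ⟨l, hl, rfl⟩ := exists_sublist_toFinset_eq (P.eligibleT X).val D
        fun j hj => Problem.mem_eligibleT.2 (hD hj)
      rw [List.toFinset_nonempty_iff] at hne
      exact ⟨l, ⟨hl, by simpa using hne⟩, rfl⟩

/-- Adding a set to the nodes and to the frontier, unless it is known. -/
def addNewT (st : List (Finset (Fin t)) × List (Finset (Fin t))) (Y : Finset (Fin t)) :
    Timed (List (Finset (Fin t)) × List (Finset (Fin t))) := do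
  let known ← searchT Y st.1
  if known then charge 1 st
  else charge 1 (Y :: st.1, Y :: st.2)

/-- Adding the children of a node to the nodes and to the frontier. -/
def Problem.expandT (P : Problem K t n) (st : List (Finset (Fin t)) × List (Finset (Fin t)))
    (X : Finset (Fin t)) : Timed (List (Finset (Fin t)) × List (Finset (Fin t))) := do
  let Ys ← P.childrenT X
  foldT addNewT st Ys

/-- Gives names to the two nested loop bodies, so that invariants can be stated for each of them. -/
theorem Problem.growT_succ (P : Problem K t n) (k : ℕ) (nodes frontier : List (Finset (Fin t))) :
    P.growT (k + 1) nodes frontier = (do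
      let r ← foldT P.expandT (nodes, []) frontier
      let nodes' ← P.growT k r.1 r.2
      charge 1 nodes') := rfl

theorem val_addNewT (st : List (Finset (Fin t)) × List (Finset (Fin t))) (Y : Finset (Fin t)) :
    (addNewT st Y).val = if Y ∈ st.1 then st else (Y :: st.1, Y :: st.2) := by
  simp only [addNewT, val_bind, val_searchT, decide_eq_true_eq]
  split_ifs <;> rfl

/-- The state of the search: the new nodes `st.2` have been added to the old ones, and each node
is listed once. -/
def Problem.Growing (P : Problem K t n) (nodes : List (Finset (Fin t)))
    (st : List (Finset (Fin t)) × List (Finset (Fin t))) : Prop :=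
  st.1 = st.2 ++ nodes ∧ st.1.Nodup ∧ ∀ Y ∈ st.1, P.Closed Y

theorem Problem.Growing.addNewT {nodes : List (Finset (Fin t))}
    {st : List (Finset (Fin t)) × List (Finset (Fin t))} (h : P.Growing nodes st)
    (hY : P.Closed Y) : P.Growing nodes (addNewT st Y).val := by
  obtain ⟨h1, h2, h3⟩ := h
  rw [val_addNewT]
  split_ifs with hmem
  · exact ⟨h1, h2, h3⟩
  · refine ⟨by simp [h1], List.nodup_cons.2 ⟨hmem, h2⟩, ?_⟩
    simpa [hY] using h3

/-- For the frontier only an inclusion holds, as known sets are not added to it. That every new node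
is on the frontier is recorded by `Growing` instead. -/
theorem mem_foldl_addNewT (l : List (Finset (Fin t)))
    (st : List (Finset (Fin t)) × List (Finset (Fin t))) :
    (∀ Z, Z ∈ (l.foldl (fun st Y => (addNewT st Y).val) st).1 ↔ Z ∈ st.1 ∨ Z ∈ l) ∧
    ∀ Z ∈ (l.foldl (fun st Y => (addNewT st Y).val) st).2, Z ∈ st.2 ∨ Z ∈ l := by
  induction l generalizing st with
  | nil => simp
  | cons Y l ih =>
    obtain ⟨h1, h2⟩ := ih (addNewT st Y).val
    rw [val_addNewT] at h1 h2
    rw [List.foldl_cons, val_addNewT]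
    refine ⟨fun Z => ?_, fun Z hZ => ?_⟩
    · rw [h1, List.mem_cons]
      split_ifs with h
      · by_cases hZ : Z = Y <;> simp_all
      · rw [List.mem_cons]
        tauto
    · have := h2 Z hZ
      rw [List.mem_cons]
      split_ifs at this with h
      · tauto
      · rw [List.mem_cons] at this
        tauto

theorem Problem.Growing.expandT {nodes : List (Finset (Fin t))}
    {st : List (Finset (Fin t)) × List (Finset (Fin t))} (h : P.Growing nodes st)
    (hX : P.Closed X) : P.Growing nodes (P.expandT st X).val := by
  simp only [Problem.expandT, val_bind, val_foldT]
  exact List.foldlRecOn _ _ h fun st hst Y hY =>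
    hst.addNewT ((Problem.mem_childrenT.1 hY).closed hX)

theorem Problem.mem_expandT (st : List (Finset (Fin t)) × List (Finset (Fin t))) :
    (∀ Z, Z ∈ (P.expandT st X).val.1 ↔ Z ∈ st.1 ∨ P.Child X Z) ∧
    ∀ Z ∈ (P.expandT st X).val.2, Z ∈ st.2 ∨ P.Child X Z := by
  simp only [Problem.expandT, val_bind, val_foldT, ← Problem.mem_childrenT]
  exact mem_foldl_addNewT _ _

theorem Problem.mem_foldT_expandT (l : List (Finset (Fin t)))
    (st : List (Finset (Fin t)) × List (Finset (Fin t))) :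
    (∀ Z, Z ∈ (foldT P.expandT st l).val.1 ↔ Z ∈ st.1 ∨ ∃ X ∈ l, P.Child X Z) ∧
    ∀ Z ∈ (foldT P.expandT st l).val.2, Z ∈ st.2 ∨ ∃ X ∈ l, P.Child X Z := by
  simp only [val_foldT]
  induction l generalizing st with
  | nil => simp
  | cons Y l ih =>
    obtain ⟨h1, h2⟩ := ih (P.expandT st Y).val
    obtain ⟨h3, h4⟩ := P.mem_expandT (X := Y) st
    rw [List.foldl_cons]
    refine ⟨fun Z => ?_, fun Z hZ => ?_⟩
    · rw [h1, h3, List.exists_mem_cons_iff, or_assoc]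
    · rw [List.exists_mem_cons_iff, ← or_assoc]
      exact (h2 Z hZ).imp_left (h4 Z)

theorem Problem.Growing.foldT_expandT {nodes l : List (Finset (Fin t))}
    {st : List (Finset (Fin t)) × List (Finset (Fin t))} (h : P.Growing nodes st)
    (hl : ∀ X ∈ l, P.Closed X) : P.Growing nodes (foldT P.expandT st l).val := by
  rw [val_foldT]
  exact List.foldlRecOn _ _ h fun st hst Y hY => hst.expandT (hl Y hY)

/-- Nodes that have left the frontier already have all their children listed, and with `k` rounds to
go the frontier sets have at least `t - k` tasks. When no round is left, a frontier set is too large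
to have a child, so the list is closed under children. -/
theorem Problem.growT_spec (k : ℕ) {nodes frontier : List (Finset (Fin t))}
    (hnodup : nodes.Nodup) (hclosed : ∀ X ∈ nodes, P.Closed X) (hsub : ∀ X ∈ frontier, X ∈ nodes)
    (hchild : ∀ X ∈ nodes, X ∉ frontier → ∀ Y, P.Child X Y → Y ∈ nodes)
    (hcard : ∀ X ∈ frontier, t ≤ X.card + k) :
    (P.growT k nodes frontier).val.Nodup ∧
    (∀ X ∈ (P.growT k nodes frontier).val, P.Closed X) ∧
    (∀ X ∈ nodes, X ∈ (P.growT k nodes frontier).val) ∧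
    ∀ X ∈ (P.growT k nodes frontier).val, ∀ Y, P.Child X Y →
      Y ∈ (P.growT k nodes frontier).val := by
  induction k generalizing nodes frontier with
  | zero =>
    refine ⟨hnodup, hclosed, fun _ h => h, fun X hX Y hY => ?_⟩
    by_cases hf : X ∈ frontier
    · have h1 := hcard X hf
      have h2 := hY.card_lt
      have h3 := Y.card_le_univ
      simp at h3
      omega
    · exact hchild X hX hf Y hY
  | succ k ih =>
    rw [Problem.growT_succ]
    simp only [val_bind, val_charge]
    obtain ⟨h1, h2, h3⟩ := Problem.Growing.foldT_expandT (P := P) (l := frontier)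
      (st := (nodes, [])) (nodes := nodes) ⟨by simp, hnodup, hclosed⟩
      fun X hX => hclosed X (hsub X hX)
    obtain ⟨h4, h5⟩ := P.mem_foldT_expandT frontier (nodes, [])
    set r := (foldT P.expandT (nodes, []) frontier).val
    obtain ⟨g1, g2, g3, g4⟩ := ih (nodes := r.1) (frontier := r.2) h2 h3
      (fun X hX => by rw [h1]; exact List.mem_append_left _ hX)
      (fun X hX hX2 Y hY => by
        have hXn : X ∈ nodes := by
          rw [h1] at hX
          exact (List.mem_append.1 hX).resolve_left hX2
        rw [h4]
        by_cases hf : X ∈ frontier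
        · exact .inr ⟨X, hf, hY⟩
        · exact .inl (hchild X hXn hf Y hY))
      (fun Y hY => by
        obtain h | ⟨X, hX, hXY⟩ := h5 Y hY
        · simp at h
        · have h1 := hcard X hX
          have h2 := hXY.card_lt
          omega)
    exact ⟨g1, g2, fun X hX => g3 X ((h4 X).2 (.inl hX)), g4⟩

theorem Problem.topologicalSortT_spec (P : Problem K t n) :
    P.topologicalSortT.val.Nodup ∧ (∀ X, X ∈ P.topologicalSortT.val ↔ P.Closed X) ∧
    P.topologicalSortT.val.Pairwise fun X Y => X.card ≤ Y.card := by
  have hperm : P.topologicalSortT.val.Perm (P.growT t [∅] [∅]).val := val_sortT_perm _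
  obtain ⟨h1, h2, h3, h4⟩ := P.growT_spec t (nodes := [∅]) (frontier := [∅]) (by simp)
    (by simpa using P.closed_empty) (by simp) (by simp +contextual) (by simp)
  refine ⟨hperm.nodup_iff.2 h1, fun X => ?_, pairwise_sortT _⟩
  rw [hperm.mem_iff]
  refine ⟨h2 X, fun hX => ?_⟩
  have hX := hX.node
  induction hX with
  | empty => exact h3 ∅ (by simp)
  | step X D _ hs hD hne ih => exact h4 X (ih (by assumption : P.Node X).closed) _ ⟨hs, D, hD, hne, rfl⟩

theorem Problem.isTopologicalSort (P : Problem K t n) :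
    P.IsTopologicalSort P.topologicalSortT.val := by
  obtain ⟨h1, h2, h3⟩ := P.topologicalSortT_spec
  refine ⟨h1, fun X => (h2 X).trans (P.node_iff_closed X).symm, h3.imp fun {X Y} h hYX => ?_⟩
  exact (Problem.Child.card_lt (P := P) hYX.2).not_ge h

theorem Problem.length_topologicalSortT_le (P : Problem K t n) :
    P.topologicalSortT.val.length ≤ (t + 1) ^ P.width :=
  P.length_le_of_closed _ P.topologicalSortT_spec.1 fun X hX => (P.topologicalSortT_spec.2.1 X).1 hX

theorem Problem.length_candidatesT_le (P : Problem K t n) (X : Finset (Fin t)) :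
    (P.candidatesT X).val.length ≤ t ^ n := by
  simp only [Problem.candidatesT, val_bind, length_assignmentsT, P.length_eligibleT]
  exact Nat.pow_le_pow_left (by simpa using (P.eligible X).card_le_univ) n

theorem Problem.mem_candidatesT {A : Fin n → Fin t} :
    A ∈ (P.candidatesT X).val ↔ ∀ i, A i ∈ P.eligible X := by
  simp [Problem.candidatesT, mem_assignmentsT, Problem.mem_eligibleT]

end Nodes

/-! ## One round of the game -/

section Round

variable {K : Type} [Field K] [LinearOrder K] {t n : ℕ} {P : Problem K t n} {X Y : Finset (Fin t)}

/-- The tasks executed in a round with assignment `A` and outcomes `o`. -/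
def hit (A : Fin n → Option (Fin t)) (o : Fin n × Fin t → Bool) : Finset (Fin t) :=
  Finset.univ.filter fun j => ∃ i, A i = some j ∧ o (i, j) = true

theorem mem_hit {A : Fin n → Option (Fin t)} {o : Fin n × Fin t → Bool} {j : Fin t} :
    j ∈ hit A o ↔ ∃ i, A i = some j ∧ o (i, j) = true := by
  simp [hit]

/-- The assignment `A` uses eligible tasks only. -/
def Problem.Admits (P : Problem K t n) (X : Finset (Fin t)) (A : Fin n → Option (Fin t)) : Prop :=
  ∀ i j, A i = some j → j ∈ P.eligible X

theorem Problem.Admits.hit_subset {A : Fin n → Option (Fin t)} (h : P.Admits X A)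
    (o : Fin n × Fin t → Bool) : hit A o ⊆ P.eligible X := by
  intro j hj
  obtain ⟨i, hi, _⟩ := mem_hit.1 hj
  exact h i j hi

/-- The probability of the outcomes `o` of a round. -/
def Problem.weight (P : Problem K t n) (o : Fin n × Fin t → Bool) : K :=
  ∏ a, if o a then P.p a.1 a.2 else 1 - P.p a.1 a.2

/-- The expectation of a function of the outcomes of a round. -/
def Problem.mean (P : Problem K t n) (f : (Fin n × Fin t → Bool) → K) : K :=
  ∑ o, P.weight o * f o

theorem Problem.mean_add (P : Problem K t n) (f g : (Fin n × Fin t → Bool) → K) :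
    P.mean (fun o => f o + g o) = P.mean f + P.mean g := by
  simp [Problem.mean, mul_add, Finset.sum_add_distrib]

theorem Problem.mean_mul_const (P : Problem K t n) (f : (Fin n × Fin t → Bool) → K) (x : K) :
    P.mean (fun o => f o * x) = P.mean f * x := by
  simp [Problem.mean, Finset.sum_mul, mul_assoc]

theorem Problem.sum_weight (P : Problem K t n) : ∑ o, P.weight o = 1 := by
  have h := Finset.prod_univ_sum (fun _ : Fin n × Fin t => (Finset.univ : Finset Bool))
    fun a b => if b then P.p a.1 a.2 else 1 - P.p a.1 a.2
  simp only [Fintype.piFinset_univ] at h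
  simp only [Problem.weight]
  rw [← h]
  simp

theorem Problem.mean_const (P : Problem K t n) (x : K) : P.mean (fun _ => x) = x := by
  simp [Problem.mean, ← Finset.sum_mul, P.sum_weight]

variable [IsStrictOrderedRing K]

theorem Problem.weight_nonneg (P : Problem K t n) (o : Fin n × Fin t → Bool) : 0 ≤ P.weight o := by
  refine Finset.prod_nonneg fun a _ => ?_
  split_ifs
  · exact P.p_nonneg _ _
  · exact sub_nonneg.2 (P.p_le_one _ _)

theorem Problem.mean_mono (P : Problem K t n) {f g : (Fin n × Fin t → Bool) → K}
    (h : ∀ o, f o ≤ g o) : P.mean f ≤ P.mean g :=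
  Finset.sum_le_sum fun o _ => mul_le_mul_of_nonneg_left (h o) (P.weight_nonneg o)

/-! ### Value functions -/

/-- At the set `X`, the assignment `R X` has no idle workers, it attains the minimum in the equation
for the value `S X`, and it executes some task with non-zero probability. -/
structure Problem.SolvesAt (P : Problem K t n) (R : Regimen t n) (S : Finset (Fin t) → K)
    (X : Finset (Fin t)) : Prop where
  eligible : ∀ i, ∃ j ∈ P.eligible X, R X i = some j
  eq : S X = 1 + P.mean fun o => S (X ∪ hit (R X) o)
  progress : (P.mean fun o => if hit (R X) o = ∅ then 1 else 0) < 1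
  le : ∀ A : Fin n → Fin t, (∀ i, A i ∈ P.eligible X) →
    S X ≤ 1 + P.mean fun o => S (X ∪ hit (fun i => some (A i)) o)

/-- `S` is the value function of the game, and `R` attains it. -/
structure Problem.Solves (P : Problem K t n) (R : Regimen t n) (S : Finset (Fin t) → K) :
    Prop where
  nonneg : ∀ X, 0 ≤ S X
  value_univ : S Finset.univ = 0
  idle_univ : ∀ i, R Finset.univ i = none
  at_closed : ∀ X, P.Closed X → X ≠ Finset.univ → P.SolvesAt R S X

variable {R : Regimen t n} {S : Finset (Fin t) → K}

omit [IsStrictOrderedRing K] in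
theorem Problem.SolvesAt.admits (h : P.SolvesAt R S X) : P.Admits X (R X) := by
  intro i j hij
  obtain ⟨k, hk, hik⟩ := h.eligible i
  rw [hij, Option.some_inj] at hik
  exact hik ▸ hk

-- The conditions at `X` involve `R` only at `X` and `S` only at sets `X ∪ D` with `D ⊆ E(X)`. This
-- protects the equations already established when the dictionary is extended.
omit [IsStrictOrderedRing K] in
theorem Problem.SolvesAt.congr {R' : Regimen t n} {S' : Finset (Fin t) → K}
    (h : P.SolvesAt R S X) (hR : R' X = R X) (hS : ∀ D ⊆ P.eligible X, S' (X ∪ D) = S (X ∪ D)) :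
    P.SolvesAt R' S' X := by
  have h0 : S' X = S X := by simpa using hS ∅ (by simp)
  have h1 : ∀ A, P.Admits X A → (fun o => S' (X ∪ hit A o)) = fun o => S (X ∪ hit A o) :=
    fun A hA => funext fun o => hS _ (hA.hit_subset o)
  refine ⟨by rw [hR]; exact h.eligible, ?_, by rw [hR]; exact h.progress, fun A hA => ?_⟩
  · rw [hR, h0, h1 _ h.admits]
    exact h.eq
  · rw [h0, h1 _ fun i j hij => by rw [← Option.some_inj.1 hij]; exact hA i]
    exact h.le A hA

/-- Having executed more tasks is never worse, and idling is never better. Both are proved by one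
induction from larger sets to smaller ones: antitonicity at `X` imitates the assignment `R X` at
`Y`, which may require idling there, while the claim on idling at `X` compares successors of `X` by
antitonicity. -/
theorem Problem.Solves.antitone_and_le (h : P.Solves R S) (X : Finset (Fin t)) (hX : P.Closed X) :
    (∀ Y, P.Closed Y → X ⊆ Y → S Y ≤ S X) ∧
    (X ≠ Finset.univ → ∀ A, P.Admits X A → S X ≤ 1 + P.mean fun o => S (X ∪ hit A o)) := by
  induction hm : t - X.card using Nat.strong_induction_on generalizing X with
  | _ m ih =>
  have ih' : ∀ Z, P.Closed Z → X ⊂ Z →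
      (∀ Y, P.Closed Y → Z ⊆ Y → S Y ≤ S Z) ∧
      (Z ≠ Finset.univ → ∀ A, P.Admits Z A → S Z ≤ 1 + P.mean fun o => S (Z ∪ hit A o)) := by
    intro Z hZ hXZ
    refine ih _ ?_ Z hZ rfl
    have h1 := Finset.card_lt_card hXZ
    have h2 := Z.card_le_univ
    simp only [Fintype.card_fin] at h2
    omega
  have hanti : ∀ Y, P.Closed Y → X ⊆ Y → S Y ≤ S X := by
    intro Y hY hXY
    rcases eq_or_ne Y Finset.univ with rfl | hYu
    · rw [h.value_univ]
      exact h.nonneg X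
    rcases hXY.eq_or_ssubset with rfl | hXY'
    · exact le_rfl
    have hXu : X ≠ Finset.univ := fun hXu => hXY'.2 (by simp [hXu])
    have hat := h.at_closed X hX hXu
    -- At `Y` the workers act as at `X`, except that those assigned to tasks already in `Y` idle;
    -- the successor of `Y` is the same as if they worked.
    let A' : Fin n → Option (Fin t) := fun i => (R X i).filter fun j => j ∉ Y
    have hA' : P.Admits Y A' := by
      intro i j hij
      obtain ⟨h1, h2⟩ := Option.filter_eq_some_iff.1 hij
      refine Problem.mem_eligible.2 ⟨by simpa using h2, fun k hk => hXY ?_⟩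
      exact (Problem.mem_eligible.1 (hat.admits i j h1)).2 k hk
    have hhit : ∀ o, Y ∪ hit A' o = Y ∪ hit (R X) o := by
      intro o
      ext j
      simp only [Finset.mem_union, mem_hit, A', Option.filter_eq_some_iff]
      by_cases hj : j ∈ Y <;> simp [hj]
    have hle := (ih' Y hY hXY').2 hYu A' hA'
    simp only [hhit] at hle
    -- If something is executed, then `X` is left for a strictly larger set, to which the induction
    -- hypothesis applies. Otherwise both sides equal `S Y`.
    have hpt : ∀ o, S (Y ∪ hit (R X) o) ≤
        S (X ∪ hit (R X) o) + (if hit (R X) o = ∅ then 1 else 0) * (S Y - S X) := by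
      intro o
      split_ifs with ho
      · simp [ho]
      · rw [zero_mul, add_zero]
        have hcl : P.Closed (X ∪ hit (R X) o) := hX.union (hat.admits.hit_subset o)
        refine (ih' _ hcl ?_).1 _ ?_ (Finset.union_subset_union_left hXY)
        · refine Finset.ssubset_iff_subset_ne.2 ⟨Finset.subset_union_left, fun heq => ?_⟩
          have := Problem.card_lt_card_union (hat.admits.hit_subset o)
            (Finset.nonempty_iff_ne_empty.2 ho)
          rw [← heq] at this
          exact this.false
        · rw [← hhit]
          exact hY.union (hA'.hit_subset o)
    have hmean := P.mean_mono hpt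
    rw [P.mean_add, P.mean_mul_const] at hmean
    have heq := hat.eq
    have hprog := hat.progress
    -- With `a` the probability that nothing is executed, the facts combine to `(1 - a) * (S Y - S
    -- X) ≤ 0`, and `a < 1`.
    nlinarith
  refine ⟨hanti, fun hXu A hA => ?_⟩
  obtain ⟨e, he⟩ := P.exists_eligible hXu
  have hat := h.at_closed X hX hXu
  -- Idle workers are sent to an arbitrary eligible task `e`, which can only enlarge the set of
  -- executed tasks.
  refine (hat.le (fun i => (A i).getD e) fun i => ?_).trans ?_
  · cases hi : A i with
    | none => exact he
    | some j => exact hA i j hi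
  · have hadm : P.Admits X fun i => some ((A i).getD e) := by
      intro i j hij
      cases hi : A i with
      | none => simp only [hi, Option.getD_none, Option.some_inj] at hij; exact hij ▸ he
      | some k => simp only [hi, Option.getD_some, Option.some_inj] at hij; exact hij ▸ hA i k hi
    refine add_le_add le_rfl (P.mean_mono fun o => ?_)
    have hsub : X ∪ hit A o ⊆ X ∪ hit (fun i => some ((A i).getD e)) o := by
      refine Finset.union_subset_union_right fun j hj => ?_
      obtain ⟨i, hi, hio⟩ := mem_hit.1 hj
      exact mem_hit.2 ⟨i, by simp [hi], hio⟩
    have hcl := hX.union (hadm.hit_subset o)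
    -- If `X` is not left under `A`, the antitonicity at `X` just proved is needed; otherwise the
    -- induction hypothesis suffices.
    rcases (Finset.subset_union_left (s₁ := X) (s₂ := hit A o)).eq_or_ssubset with heq | hss
    · rw [← heq] at hsub ⊢
      exact hanti _ hcl hsub
    · exact (ih' _ (hX.union (hA.hit_subset o)) hss).1 _ hcl hsub

theorem Problem.Solves.le_of_admits (h : P.Solves R S) (hX : P.Closed X) (hXu : X ≠ Finset.univ)
    {A : Fin n → Option (Fin t)} (hA : P.Admits X A) :
    S X ≤ 1 + P.mean fun o => S (X ∪ hit A o) :=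
  (h.antitone_and_le X hX).2 hXu A hA

omit [IsStrictOrderedRing K] in
theorem Problem.Solves.isRegimen (h : P.Solves R S) : P.IsRegimen R := by
  intro Z hZ i j hij
  rcases eq_or_ne Z Finset.univ with rfl | hZu
  · simp [h.idle_univ] at hij
  · exact (h.at_closed Z hZ hZu).admits i j hij

end Round

/-! ### Transfer from rational to real probabilities -/

section Cast

variable {t n : ℕ}

theorem Problem.mean_toReal (P : Problem ℚ t n) (f : (Fin n × Fin t → Bool) → ℚ) :
    P.toReal.mean (fun o => (f o : ℝ)) = (P.mean f : ℝ) := by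
  simp only [Problem.mean, Problem.weight, Problem.toReal]
  push_cast [apply_ite (Rat.cast : ℚ → ℝ)]
  rfl

theorem Problem.Solves.toReal {P : Problem ℚ t n} {R : Regimen t n} {S : Finset (Fin t) → ℚ}
    (h : P.Solves R S) : P.toReal.Solves R fun X => (S X : ℝ) where
  nonneg X := by exact_mod_cast h.nonneg X
  value_univ := by exact_mod_cast h.value_univ
  idle_univ := h.idle_univ
  at_closed X hX hXu := by
    obtain ⟨h1, h2, h3, h4⟩ := h.at_closed X hX hXu
    refine ⟨h1, ?_, ?_, fun A hA => ?_⟩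
    · rw [Problem.mean_toReal]
      exact_mod_cast h2
    · have := P.mean_toReal fun o => if hit (R X) o = ∅ then 1 else 0
      push_cast [apply_ite (Rat.cast : ℚ → ℝ)] at this
      rw [this]
      exact_mod_cast h3
    · rw [Problem.mean_toReal]
      exact_mod_cast h4 A hA

end Cast

/-! ## Probabilities of the outcomes of an assignment -/

section Probability

variable {K : Type} [Field K] [LinearOrder K] {t n : ℕ} {P : Problem K t n}

/-- The probability that all workers assigned by `A` to `j` fail. -/
def Problem.failure (P : Problem K t n) (A : Fin n → Fin t) (j : Fin t) : K :=
  ∏ i, if A i = j then 1 - P.p i j else 1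

/-- The probability that `A` executes exactly the tasks in `D`. -/
def Problem.exactly (P : Problem K t n) (A : Fin n → Fin t) (D : Finset (Fin t)) : K :=
  ∏ j, if j ∈ D then 1 - P.failure A j else P.failure A j

/-- The attempts at a single task `j`: the probability that all assigned workers fail factors over
the workers, and success is the complementary event. The proposition `b` will be `j ∈ D`. -/
theorem Problem.sum_weight_column (P : Problem K t n) (A : Fin n → Fin t) (j : Fin t)
    (b : Prop) [Decidable b] :
    ∑ x : Fin n → Bool, (∏ i, if x i then P.p i j else 1 - P.p i j) *
      (if (∃ i, A i = j ∧ x i = true) ↔ b then 1 else 0) =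
    if b then 1 - P.failure A j else P.failure A j := by
  have htotal : ∑ x : Fin n → Bool, (∏ i, if x i then P.p i j else 1 - P.p i j) = 1 := by
    have h := Finset.prod_univ_sum (fun _ : Fin n => (Finset.univ : Finset Bool))
      fun i b => if b then P.p i j else 1 - P.p i j
    simp only [Fintype.piFinset_univ] at h
    rw [← h]
    simp
  have hfail : ∑ x : Fin n → Bool, (∏ i, if x i then P.p i j else 1 - P.p i j) *
      (if ∃ i, A i = j ∧ x i = true then 0 else 1) = P.failure A j := by
    have h := Finset.prod_univ_sum (fun _ : Fin n => (Finset.univ : Finset Bool))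
      fun i b => (if b then P.p i j else 1 - P.p i j) * (if A i = j ∧ b = true then 0 else 1)
    simp only [Fintype.piFinset_univ] at h
    rw [Problem.failure]
    refine Eq.trans ?_ (h.symm.trans ?_)
    · refine Finset.sum_congr rfl fun x _ => ?_
      rw [Finset.prod_mul_distrib]
      congr 1
      split_ifs with hx
      · obtain ⟨i, hi⟩ := hx
        exact (Finset.prod_eq_zero (Finset.mem_univ i) (by simp [hi])).symm
      · push Not at hx
        exact (Finset.prod_eq_one fun i _ => by simpa using hx i).symm
    · refine Finset.prod_congr rfl fun i _ => ?_
      by_cases hi : A i = j <;> simp [hi]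
  split_ifs with hb
  · rw [eq_sub_iff_add_eq, ← hfail, ← Finset.sum_add_distrib]
    refine Eq.trans (Finset.sum_congr rfl fun x _ => ?_) htotal
    by_cases hx : ∃ i, A i = j ∧ x i = true <;> simp [hx, hb]
  · rw [← hfail]
    refine Finset.sum_congr rfl fun x _ => ?_
    by_cases hx : ∃ i, A i = j ∧ x i = true <;> simp [hx, hb]

/-- Outcomes, sorted by task. -/
def columns (t n : ℕ) : (Fin n × Fin t → Bool) ≃ (Fin t → Fin n → Bool) where
  toFun o j i := o (i, j)
  invFun x a := x a.2 a.1
  left_inv _ := rfl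
  right_inv _ := rfl

/-- Attempts at different tasks are independent, so after sorting the outcomes by task the sum over
all outcomes factors into sums over columns. -/
theorem Problem.mean_hit_eq (P : Problem K t n) (A : Fin n → Fin t) (D : Finset (Fin t)) :
    P.mean (fun o => if hit (fun i => some (A i)) o = D then 1 else 0) = P.exactly A D := by
  have h := Finset.prod_univ_sum (fun _ : Fin t => (Finset.univ : Finset (Fin n → Bool)))
    fun j x => (∏ i, if x i then P.p i j else 1 - P.p i j) *
      (if (∃ i, A i = j ∧ x i = true) ↔ j ∈ D then 1 else 0)
  simp only [Fintype.piFinset_univ, P.sum_weight_column] at h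
  rw [Problem.exactly, h, Problem.mean]
  refine Fintype.sum_equiv (columns t n) _ _ fun o => ?_
  rw [Finset.prod_mul_distrib, Problem.weight, Fintype.prod_prod_type_right]
  simp only [columns, Equiv.coe_fn_mk]
  congr 1
  split_ifs with ho
  · refine (Finset.prod_eq_one fun j _ => ?_).symm
    refine if_pos ?_
    rw [← ho, mem_hit]
    simp
  · have : ∃ j, ¬ ((∃ i, A i = j ∧ o (i, j) = true) ↔ j ∈ D) := by
      by_contra! hall
      refine ho (Finset.ext fun j => ?_)
      rw [mem_hit, ← hall]
      simp
    obtain ⟨j, hj⟩ := this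
    exact (Finset.prod_eq_zero (Finset.mem_univ j) (if_neg hj)).symm

theorem Problem.mean_comp_hit (P : Problem K t n) (A : Fin n → Fin t) (I : Finset (Fin t))
    (hI : ∀ i, A i ∈ I) (g : Finset (Fin t) → K) :
    P.mean (fun o => g (hit (fun i => some (A i)) o)) =
      ∑ D ∈ I.powerset, P.exactly A D * g D := by
  simp only [← P.mean_hit_eq, Problem.mean, Finset.sum_mul]
  rw [Finset.sum_comm]
  refine Finset.sum_congr rfl fun o _ => ?_
  have hmem : hit (fun i => some (A i)) o ∈ I.powerset := by
    refine Finset.mem_powerset.2 fun j hj => ?_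
    obtain ⟨i, hi, _⟩ := mem_hit.1 hj
    exact Option.some_inj.1 hi ▸ hI i
  rw [Finset.sum_eq_single_of_mem _ hmem]
  · simp
  · intro D _ hD
    simp [hD.symm]

variable [IsStrictOrderedRing K]

theorem Problem.exactly_le_one (P : Problem K t n) (A : Fin n → Fin t) (D : Finset (Fin t)) :
    P.exactly A D ≤ 1 := by
  rw [← P.mean_hit_eq]
  exact (P.mean_mono fun o => by split_ifs <;> simp).trans_eq (P.mean_const 1)

/-- Some assignment executes a task with non-zero probability. -/
theorem Problem.exists_exactly_empty_ne_one (P : Problem K t n) {X : Finset (Fin t)}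
    (hX : X ≠ Finset.univ) :
    ∃ A : Fin n → Fin t, (∀ i, A i ∈ P.eligible X) ∧ P.exactly A ∅ ≠ 1 := by
  obtain ⟨j, hj⟩ := P.exists_eligible hX
  obtain ⟨i, hi⟩ := P.exists_pos j
  have hle : ∀ k l, P.p k l ≤ 1 := P.p_le_one
  have hnn : ∀ k l, 0 ≤ P.p k l := P.p_nonneg
  -- All workers attempt the same eligible task `j`, and one of them succeeds with positive
  -- probability.
  refine ⟨fun _ => j, fun _ => hj, ne_of_lt ?_⟩
  have hlt : P.failure (fun _ => j) j < 1 := by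
    simp only [Problem.failure, if_true]
    rw [← Finset.mul_prod_erase _ _ (Finset.mem_univ i)]
    calc _ ≤ (1 - P.p i j) * 1 := by
          refine mul_le_mul_of_nonneg_left ?_ (sub_nonneg.2 (hle i j))
          exact Finset.prod_le_one (fun k _ => sub_nonneg.2 (hle k j))
            fun k _ => sub_le_self _ (hnn k j)
      _ < 1 := by linarith
  rw [Problem.exactly, Finset.prod_eq_single_of_mem j (Finset.mem_univ j)]
  · simpa using hlt
  · intro k _ hk
    simp [Problem.failure, hk.symm]

end Probability

/-! ## Values computed by OPT -/

section Folds

variable {K : Type} [Field K]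

theorem foldl_mul_eq {α : Type} (g : α → K) (l : List α) (x : K) :
    l.foldl (fun x a => x * g a) x = x * (l.map g).prod := by
  induction l generalizing x with
  | nil => simp
  | cons a l ih => simp [ih, mul_assoc]

theorem foldl_add_eq {α : Type} (g : α → K) (l : List α) (x : K) :
    l.foldl (fun x a => x + g a) x = x + (l.map g).sum := by
  induction l generalizing x with
  | nil => simp
  | cons a l ih => simp [ih, add_assoc]

theorem sum_map_sublists' {α : Type} [DecidableEq α] (g : Finset α → K) (l : List α)
    (hl : l.Nodup) :
    (l.sublists'.map fun D => g D.toFinset).sum = ∑ D ∈ l.toFinset.powerset, g D := by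
  induction l generalizing g with
  | nil => simp
  | cons a l ih =>
    rw [List.nodup_cons] at hl
    rw [List.sublists'_cons, List.map_append, List.sum_append, List.toFinset_cons,
      Finset.sum_powerset_insert (by simpa using hl.1), ih g hl.2, List.map_map,
      ← ih (fun D => g (insert a D)) hl.2]
    congr 3
    ext D
    simp

theorem mem_foldl_insert {α β : Type} [DecidableEq α] (f : β → α) (l : List β) (acc : List α)
    (h : acc.Nodup) :
    (l.foldl (fun acc i => if f i ∈ acc then acc else f i :: acc) acc).Nodup ∧
    ∀ a, a ∈ l.foldl (fun acc i => if f i ∈ acc then acc else f i :: acc) acc ↔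
      a ∈ acc ∨ ∃ i ∈ l, f i = a := by
  induction l generalizing acc with
  | nil => simpa using h
  | cons i l ih =>
    rw [List.foldl_cons]
    split_ifs with hi
    · refine ⟨(ih acc h).1, fun a => ?_⟩
      rw [(ih acc h).2, List.exists_mem_cons_iff, ← or_assoc]
      by_cases ha : f i = a
      · subst ha
        simp [hi]
      · simp [ha]
    · have h' := List.nodup_cons.2 ⟨hi, h⟩
      refine ⟨(ih _ h').1, fun a => ?_⟩
      rw [(ih _ h').2, List.exists_mem_cons_iff, List.mem_cons, or_comm (a := a = f i), or_assoc,
        eq_comm]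

end Folds

/-- The search for a minimum, with `none` as `∞`. Elements satisfying `ok` are passed over; the
application takes for `ok` the condition `a_∅ = 1`. -/
theorem foldl_minimum {K : Type} [LinearOrder K] {α : Type} (ok : α → Prop) [DecidablePred ok] (v : α → K)
    (step : Option (K × α) → α → Option (K × α))
    (hstep : ∀ best a, step best a = if ok a then best else
      match best with
      | none => some (v a, a)
      | some b => if v a < b.1 then some (v a, a) else some b)
    (l : List α) (best : Option (K × α))
    (hbest : ∀ b, best = some b → ¬ ok b.2 ∧ b.1 = v b.2) :
    (∀ b, l.foldl step best = some b →
      (b.2 ∈ l ∨ best = some b) ∧ ¬ ok b.2 ∧ b.1 = v b.2) ∧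
    (∀ b₀, best = some b₀ → ∃ b, l.foldl step best = some b ∧ b.1 ≤ b₀.1) ∧
    ∀ a ∈ l, ¬ ok a → ∃ b, l.foldl step best = some b ∧ b.1 ≤ v a := by
  induction l generalizing best with
  | nil =>
    refine ⟨fun b hb => ⟨.inr hb, hbest b hb⟩, fun b hb => ⟨b, hb, le_rfl⟩, by simp⟩
  | cons a l ih =>
    rw [List.foldl_cons]
    by_cases hok : ok a
    · rw [hstep, if_pos hok]
      obtain ⟨h1, h2, h3⟩ := ih best hbest
      refine ⟨fun b hb => ⟨?_, (h1 b hb).2⟩, h2, fun a' ha' hok' => ?_⟩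
      · exact (h1 b hb).1.imp_left (List.mem_cons_of_mem a)
      · rcases List.mem_cons.1 ha' with rfl | ha'
        · exact absurd hok hok'
        · exact h3 a' ha' hok'
    · have key : ∃ b₁, step best a = some b₁ ∧ (b₁ = (v a, a) ∨ best = some b₁) ∧ b₁.1 ≤ v a ∧
          ∀ b₀, best = some b₀ → b₁.1 ≤ b₀.1 := by
        rw [hstep, if_neg hok]
        cases best with
        | none => exact ⟨_, rfl, .inl rfl, le_rfl, by simp⟩
        | some b =>
          dsimp only
          split_ifs with hlt
          · refine ⟨_, rfl, .inl rfl, le_rfl, fun b₀ hb₀ => ?_⟩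
            rw [← Option.some_inj.1 hb₀]
            exact hlt.le
          · refine ⟨_, rfl, .inr rfl, not_lt.1 hlt, fun b₀ hb₀ => ?_⟩
            rw [← Option.some_inj.1 hb₀]
      obtain ⟨b₁, hb₁, hor, hle, hle'⟩ := key
      obtain ⟨h1, h2, h3⟩ := ih (step best a) (by
        rintro b hb
        rw [hb₁, Option.some_inj] at hb
        subst hb
        rcases hor with rfl | hor
        · exact ⟨hok, rfl⟩
        · exact hbest _ hor)
      obtain ⟨b₂, hb₂, hle₂⟩ := h2 b₁ hb₁
      refine ⟨fun b hb => ⟨?_, (h1 b hb).2⟩, fun b₀ hb₀ => ⟨b₂, hb₂, hle₂.trans (hle' b₀ hb₀)⟩,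
        fun a' ha' hok' => ?_⟩
      · rcases (h1 b hb).1 with h | h
        · exact .inl (List.mem_cons_of_mem a h)
        · rw [hb₁, Option.some_inj] at h
          subst h
          rcases hor with rfl | hor
          · exact .inl (by simp)
          · exact .inr hor
      · rcases List.mem_cons.1 ha' with rfl | ha'
        · exact ⟨b₂, hb₂, hle₂.trans hle⟩
        · exact h3 a' ha' hok'

/-! ### Reading the dictionary -/

section Dictionary

variable {K : Type} [Field K] {t n : ℕ}

/-- The value stored for `X`. -/
def Table.value (S : Table K t n) (X : Finset (Fin t)) : K := (lookupT X S).val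

theorem Table.value_cons (e : Finset (Fin t) × K × (Fin n → Option (Fin t))) (S : Table K t n)
    (X : Finset (Fin t)) : Table.value (e :: S) X = if X = e.1 then e.2.1 else S.value X := by
  by_cases h : X = e.1 <;> simp [Table.value, lookupT, h]

theorem Table.regimen_cons {K : Type} {t n : ℕ} (e : Finset (Fin t) × K × (Fin n → Option (Fin t))) (S : Table K t n)
    (X : Finset (Fin t)) : Table.regimen (e :: S) X = if X = e.1 then e.2.2 else S.regimen X := by
  by_cases h : X = e.1
  · funext i
    simp [Table.regimen, h]
  · funext i
    simp [Table.regimen, h, Ne.symm h]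

end Dictionary

/-! ### Correctness of the values and of the regimen computed by OPT -/

section Values

variable {K : Type} [Field K] [LinearOrder K] {t n : ℕ} {P : Problem K t n} {c : K → K → ℕ}

theorem Problem.val_failT (P : Problem K t n) (c : K → K → ℕ) (A : Fin n → Fin t) (j : Fin t) :
    (P.failT c A j).val = P.failure A j := by
  have hstep : ∀ (x : K) (i : Fin n), (if A i = j then do
      let f ← charge (1 + c 1 (P.p i j)) (1 - P.p i j)
      charge (c x f) (x * f)
    else charge 1 x : Timed K).val = x * (if A i = j then 1 - P.p i j else 1) := by
    intro x i
    split_ifs <;> simp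
  simp only [Problem.failT, val_bind, val_foldT, val_rangeT, hstep]
  rw [foldl_mul_eq, one_mul, Problem.failure, Fin.prod_univ_def]

theorem nodup_assignedT (A : Fin n → Fin t) : (assignedT A).val.Nodup := by
  simpa [assignedT] using (mem_foldl_insert A (List.finRange n) [] List.nodup_nil).1

theorem mem_assignedT {A : Fin n → Fin t} {j : Fin t} :
    j ∈ (assignedT A).val ↔ ∃ i, A i = j := by
  simpa [assignedT] using (mem_foldl_insert A (List.finRange n) [] List.nodup_nil).2 j

/-- A task without workers fails surely and is not in `D`, so its factor is `1` and the loop may be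
restricted to the assigned tasks. -/
theorem Problem.val_probT (P : Problem K t n) (c : K → K → ℕ) (A : Fin n → Fin t)
    {D : List (Fin t)} (hD : D ⊆ (assignedT A).val) :
    (P.probT c A (assignedT A).val D).val = P.exactly A D.toFinset := by
  have hstep : ∀ (x : K) (j : Fin t), (do
      let f ← P.failT c A j
      let inD ← charge (D.length + 1) (decide (j ∈ D))
      if inD then
        let s ← charge (c 1 f) (1 - f)
        charge (c x s) (x * s)
      else charge (c x f) (x * f) : Timed K).val =
      x * (if j ∈ D.toFinset then 1 - P.failure A j else P.failure A j) := by
    intro x j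
    by_cases h : j ∈ D <;> simp [h, P.val_failT]
  simp only [Problem.probT, val_foldT, hstep]
  rw [foldl_mul_eq, one_mul, Problem.exactly, ← List.prod_toFinset _ (nodup_assignedT A)]
  refine Finset.prod_subset (Finset.subset_univ _) fun j _ hj => ?_
  rw [List.mem_toFinset] at hj
  rw [if_neg fun h => hj (hD (List.mem_toFinset.1 h)), Problem.failure]
  refine Finset.prod_eq_one fun i _ => if_neg fun h => hj (mem_assignedT.2 ⟨i, h⟩)

/-- The loop omits `D = ∅`, so the sum is the full expectation minus the term of the empty set. The
entry `S.value Y` on the right cancels; its value is irrelevant. -/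
theorem Problem.val_sumT (P : Problem K t n) (c : K → K → ℕ) (S : Table K t n)
    (Y : Finset (Fin t)) (A : Fin n → Fin t) :
    (P.sumT c S Y A (assignedT A).val).val =
      P.mean (fun o => S.value (Y ∪ hit (fun i => some (A i)) o)) -
        P.exactly A ∅ * S.value Y := by
  have hstep : ∀ (x : K), ∀ D ∈ (assignedT A).val.sublists', (if D.isEmpty then charge 1 x
    else do
      let a ← P.probT c A (assignedT A).val D
      let Z ← unionT Y D
      let s ← lookupT Z S
      let y ← charge (c a s) (a * s)
      charge (c x y) (x + y) : Timed K).val =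
      x + (if D.toFinset = ∅ then 0 else P.exactly A D.toFinset * S.value (Y ∪ D.toFinset)) := by
    intro x D hD
    by_cases h : D = []
    · simp [h]
    · simp [h, P.val_probT c A (List.mem_sublists'.1 hD).subset, Table.value]
  simp only [Problem.sumT, val_bind, val_foldT, val_sublistsT]
  rw [List.foldl_ext _ _ _ hstep, foldl_add_eq, zero_add,
    sum_map_sublists' (fun D => if D = ∅ then 0 else P.exactly A D * S.value (Y ∪ D)) _
      (nodup_assignedT A),
    P.mean_comp_hit A (assignedT A).val.toFinset
      (fun i => List.mem_toFinset.2 (mem_assignedT.2 ⟨i, rfl⟩)) fun D => S.value (Y ∪ D),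
    ← Finset.add_sum_erase _ _ (Finset.empty_mem_powerset _),
    ← Finset.add_sum_erase _ (fun D => P.exactly A D * S.value (Y ∪ D))
      (Finset.empty_mem_powerset _)]
  simp only [if_true, Finset.union_empty, zero_add, add_sub_cancel_left]
  exact Finset.sum_congr rfl fun D hD => if_neg (Finset.ne_of_mem_erase hD)

/-- The value of the candidate `A` at `Y`, if a task is executed with non-zero probability. -/
def Problem.candidateValue (P : Problem K t n) (S : Table K t n) (Y : Finset (Fin t))
    (A : Fin n → Fin t) : K :=
  (1 + (P.mean (fun o => S.value (Y ∪ hit (fun i => some (A i)) o)) -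
    P.exactly A ∅ * S.value Y)) / (1 - P.exactly A ∅)

theorem Problem.val_tryT (P : Problem K t n) (c : K → K → ℕ) (S : Table K t n)
    (Y : Finset (Fin t)) (best : Option (K × (Fin n → Fin t))) (A : Fin n → Fin t) :
    (P.tryT c S Y best A).val = if P.exactly A ∅ = 1 then best else
      match best with
      | none => some (P.candidateValue S Y A, A)
      | some b => if P.candidateValue S Y A < b.1 then some (P.candidateValue S Y A, A)
        else some b := by
  have h0 : (1 - P.exactly A ∅ = 0) ↔ P.exactly A ∅ = 1 := by
    rw [sub_eq_zero, eq_comm]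
  simp only [Problem.tryT, val_bind, val_charge, P.val_sumT, P.val_probT c A (List.nil_subset _),
    List.toFinset_nil, decide_eq_true_eq, h0]
  split_ifs with h
  · rfl
  · cases best <;> rfl

variable [IsStrictOrderedRing K]

theorem Problem.processT_spec (P : Problem K t n) (c : K → K → ℕ) (S : Table K t n)
    (Y : Finset (Fin t)) (hY : Y ≠ Finset.univ) :
    ∃ A : Fin n → Fin t,
      (P.processT c S Y).val = (Y, P.candidateValue S Y A, fun i => some (A i)) :: S ∧
      (∀ i, A i ∈ P.eligible Y) ∧ P.exactly A ∅ ≠ 1 ∧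
      ∀ B : Fin n → Fin t, (∀ i, B i ∈ P.eligible Y) → P.exactly B ∅ ≠ 1 →
        P.candidateValue S Y A ≤ P.candidateValue S Y B := by
  classical
  obtain ⟨h1, -, h3⟩ := foldl_minimum (fun A => P.exactly A ∅ = 1) (P.candidateValue S Y)
    (fun best A => (P.tryT c S Y best A).val) (fun best A => by
      rw [P.val_tryT]
      cases best <;> rfl)
    (P.candidatesT Y).val none (by simp)
  obtain ⟨A₀, hA₀, hne⟩ := P.exists_exactly_empty_ne_one hY
  obtain ⟨b, hb, -⟩ := h3 A₀ (Problem.mem_candidatesT.2 hA₀) hne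
  obtain ⟨hmem, hok, hval⟩ := h1 b hb
  refine ⟨b.2, ?_, ?_, hok, fun B hB hBne => ?_⟩
  · simp only [Problem.processT, val_bind, val_foldT, hb, ← hval]
    rfl
  · simpa [Problem.mem_candidatesT] using hmem
  · obtain ⟨b', hb', hle⟩ := h3 B (Problem.mem_candidatesT.2 hB) hBne
    rw [hb, Option.some_inj] at hb'
    rw [← hval, hb']
    exact hle

/-- The left side is one term of an expectation of a nonnegative function. It yields nonnegativity
of the new value and disposes of candidates with `a_∅ = 1`. -/
theorem Problem.exactly_empty_mul_le (P : Problem K t n) (A : Fin n → Fin t)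
    {f : Finset (Fin t) → K} (hf : ∀ X, 0 ≤ f X) (Y : Finset (Fin t)) :
    P.exactly A ∅ * f Y ≤ P.mean fun o => f (Y ∪ hit (fun i => some (A i)) o) := by
  rw [← P.mean_hit_eq, ← P.mean_mul_const]
  refine P.mean_mono fun o => ?_
  split_ifs with h
  · simp [h]
  · simpa using hf _

/-- The state of the dictionary when the sets outside `L` have been processed. -/
structure Problem.Processed (P : Problem K t n) (S : Table K t n) (L : List (Finset (Fin t))) :
    Prop where
  nonneg : ∀ X, 0 ≤ S.value X
  value_univ : S.value Finset.univ = 0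
  idle_univ : ∀ i, S.regimen Finset.univ i = none
  card_le : ∀ X, P.Closed X → X ∉ L → ∀ Y ∈ L, Y.card ≤ X.card
  solves : ∀ X, P.Closed X → X ≠ Finset.univ → X ∉ L → P.SolvesAt S.regimen S.value X

theorem Problem.Processed.processT {S : Table K t n} {Y : Finset (Fin t)}
    {L : List (Finset (Fin t))} (h : P.Processed S (Y :: L))
    (hYu : Y ≠ Finset.univ) (hcard : ∀ X ∈ L, X.card ≤ Y.card) :
    P.Processed (P.processT c S Y).val L := by
  obtain ⟨A, hval, hA, hne, hmin⟩ := P.processT_spec c S Y hYu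
  have hA0 := P.exactly_empty_mul_le A h.nonneg Y
  have hA1 : 0 < 1 - P.exactly A ∅ := sub_pos.2 (lt_of_le_of_ne (P.exactly_le_one A ∅) hne)
  have hv : P.candidateValue S Y A * (1 - P.exactly A ∅) = 1 +
      (P.mean (fun o => S.value (Y ∪ hit (fun i => some (A i)) o)) -
        P.exactly A ∅ * S.value Y) := div_mul_cancel₀ _ hA1.ne'
  have hv0 : 0 ≤ P.candidateValue S Y A := div_nonneg (by linarith) hA1.le
  rw [hval]
  set v := P.candidateValue S Y A with hvdef
  set S' : Table K t n := (Y, v, fun i => some (A i)) :: S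
  have hvalue : ∀ X, S'.value X = if X = Y then v else S.value X := fun X =>
    Table.value_cons _ _ _
  have hregimen : ∀ X, S'.regimen X = if X = Y then fun i => some (A i) else S.regimen X :=
    fun X => Table.regimen_cons _ _ _
  -- The dictionaries differ only at `Y`, and the successor of `Y` is `Y` exactly when nothing is
  -- executed.
  have hmean : ∀ B : Fin n → Fin t, (∀ i, B i ∈ P.eligible Y) →
      P.mean (fun o => S'.value (Y ∪ hit (fun i => some (B i)) o)) =
      P.mean (fun o => S.value (Y ∪ hit (fun i => some (B i)) o)) +
        P.exactly B ∅ * (v - S.value Y) := by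
    intro B hB
    rw [← P.mean_hit_eq, ← P.mean_mul_const, ← P.mean_add]
    congr 1
    funext o
    have hadm : P.Admits Y fun i => some (B i) := fun i j hij => Option.some_inj.1 hij ▸ hB i
    rw [hvalue]
    by_cases ho : hit (fun i => some (B i)) o = ∅
    · simp [ho]
    · have := Problem.card_lt_card_union (hadm.hit_subset o) (Finset.nonempty_iff_ne_empty.2 ho)
      rw [if_neg fun heq => by rw [heq] at this; exact this.false, if_neg ho]
      simp
  refine ⟨fun X => ?_, ?_, fun i => ?_, fun X hX hXL Z hZ => ?_, fun X hX hXu hXL => ?_⟩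
  · rw [hvalue]
    split_ifs
    · exact hv0
    · exact h.nonneg X
  · rw [hvalue, if_neg hYu.symm, h.value_univ]
  · rw [hregimen, if_neg hYu.symm, h.idle_univ]
  · by_cases hXY : X = Y
    · exact hXY ▸ hcard Z hZ
    · exact h.card_le X hX (by simp [hXY, hXL]) Z (by simp [hZ])
  · by_cases hXY : X = Y
    · subst hXY
      have hRX : S'.regimen X = fun i => some (A i) := by rw [hregimen, if_pos rfl]
      have hSX : S'.value X = v := by rw [hvalue, if_pos rfl]
      refine ⟨fun i => ⟨A i, hA i, by rw [hRX]⟩, ?_, ?_, fun B hB => ?_⟩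
      · rw [hRX, hmean A hA, hSX]
        linear_combination hv
      · rw [hRX, P.mean_hit_eq]
        exact sub_pos.1 hA1
      · rw [hmean B hB, hSX]
        have hB0 := P.exactly_empty_mul_le B h.nonneg X
        -- Candidates with `a_∅ = 1` were skipped, but for them the claim becomes `v ≤ 1 + (mean + v
        -- - S.value X)`, which follows from `hB0`.
        by_cases hB1 : P.exactly B ∅ = 1
        · rw [hB1] at hB0 ⊢
          linarith
        · have hpos : 0 < 1 - P.exactly B ∅ :=
            sub_pos.2 (lt_of_le_of_ne (P.exactly_le_one B ∅) hB1)
          have := (le_div_iff₀ hpos).1 (hmin B hB hB1)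
          linarith
    · have hXL' : X ∉ Y :: L := by simp [hXY, hXL]
      have hat := h.solves X hX hXu hXL'
      refine hat.congr (by rw [hregimen, if_neg hXY]) fun D hD => ?_
      rw [hvalue, if_neg]
      -- The new entry is not read by the equation at `X`: a proper successor of `X` has more tasks
      -- than `X`, hence more than `Y`.
      intro heq
      rcases D.eq_empty_or_nonempty with rfl | hne
      · exact hXY (by simpa using heq)
      · have h1 := Problem.card_lt_card_union hD hne
        have h2 := h.card_le X hX hXL' Y (by simp)
        rw [heq] at h1
        omega

theorem Problem.Processed.foldT {L : List (Finset (Fin t))} {S : Table K t n}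
    (h : P.Processed S L) (hL : ∀ Y ∈ L, Y ≠ Finset.univ)
    (hcard : L.Pairwise fun X Y => Y.card ≤ X.card) :
    P.Processed (foldT (fun S Y => P.processT c S Y) S L).val [] := by
  rw [val_foldT]
  induction L generalizing S with
  | nil => exact h
  | cons Y L ih =>
    rw [List.pairwise_cons] at hcard
    exact ih (h.processT (hL Y (by simp)) hcard.1) (fun X hX => hL X (by simp [hX])) hcard.2

theorem Problem.solves_optRegimen (P : Problem K t n) (c : K → K → ℕ) :
    ∃ S, P.Solves (P.optRegimen c) S := by
  obtain ⟨h1, h2, h3⟩ := P.topologicalSortT_spec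
  rw [← List.nodup_reverse] at h1
  rw [← List.pairwise_reverse] at h3
  simp only [← List.mem_reverse (as := P.topologicalSortT.val)] at h2
  simp only [Problem.optRegimen, Problem.optT, val_bind, val_reverseT]
  generalize P.topologicalSortT.val.reverse = Zs at h1 h2 h3
  cases Zs with
  | nil => simpa using (h2 ∅).2 P.closed_empty
  | cons Ym L =>
    rw [List.nodup_cons] at h1
    rw [List.pairwise_cons] at h3
    -- The head of the reversed list has maximal cardinality, and the full set is closed, so it is
    -- in the list.
    have hYm : Ym = Finset.univ := by
      have hmem := (h2 Finset.univ).2 fun _ _ i _ => Finset.mem_univ i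
      rcases List.mem_cons.1 hmem with h | h
      · exact h.symm
      · exact (Finset.card_eq_iff_eq_univ _).1 (le_antisymm Ym.card_le_univ (h3.1 _ h))
    subst hYm
    have hvalue : ∀ X, Table.value [((Finset.univ : Finset (Fin t)), (0 : K),
        fun _ : Fin n => (none : Option (Fin t)))] X = 0 := by
      intro X
      rw [Table.value_cons]
      split_ifs <;> rfl
    have hout : ∀ X, P.Closed X → X ∉ L → X = Finset.univ := fun X hX hXL =>
      (List.mem_cons.1 ((h2 X).2 hX)).resolve_right hXL
    have h := Problem.Processed.foldT (P := P) (c := c) (L := L)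
      (S := [(Finset.univ, 0, fun _ => none)])
      ⟨fun X => (hvalue X).ge, hvalue _, fun i => by rw [Table.regimen_cons, if_pos rfl],
        fun X hX hXL Y _ => hout X hX hXL ▸ Y.card_le_univ,
        fun X hX hXu hXL => absurd (hout X hX hXL) hXu⟩
      (fun Y hY hYu => h1.1 (hYu ▸ hY)) h3.2
    exact ⟨_, h.nonneg, h.value_univ, h.idle_univ, fun X hX hXu => h.solves X hX hXu (by simp)⟩

end Values

/-! ## Expected completion times -/

section Law

/-- The sequence with first element `a` and the further elements `f`. -/
def consSeq {α : Type} (x : α × (ℕ → α)) : ℕ → α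
  | 0 => x.1
  | k + 1 => x.2 k

theorem measurable_consSeq {α : Type} [MeasurableSpace α] :
    Measurable (consSeq : α × (ℕ → α) → ℕ → α) := by
  refine measurable_pi_lambda _ fun k => ?_
  cases k with
  | zero => exact measurable_fst
  | succ k => exact (measurable_pi_apply k).comp measurable_snd

/-- Independent repetitions can be split into the first round and the rest. It suffices to compare
the measures on finite-dimensional boxes. -/
theorem map_consSeq_prod_infinitePi {α : Type} [MeasurableSpace α] (μ : Measure α)
    [IsProbabilityMeasure μ] :
    (μ.prod (Measure.infinitePi fun _ : ℕ => μ)).map consSeq = Measure.infinitePi fun _ => μ := by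
  classical
  refine Measure.eq_infinitePi _ fun s B hB => ?_
  obtain ⟨N, hN⟩ : ∃ N, s ⊆ Finset.range (N + 1) :=
    ⟨s.sup id, fun i hi => Finset.mem_range.2 (Nat.lt_succ_of_le (Finset.le_sup (f := id) hi))⟩
  -- Unrestricted coordinates get the full space, so that the box can be described by an initial
  -- segment of indices and then shifted.
  let B' : ℕ → Set α := fun i => if i ∈ s then B i else Set.univ
  have hB' : ∀ i, MeasurableSet (B' i) := fun i => by
    by_cases h : i ∈ s <;> simp [B', h, hB]
  have hpre : consSeq ⁻¹' (Set.pi s B) =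
      B' 0 ×ˢ Set.pi (Finset.range N : Set ℕ) fun k => B' (k + 1) := by
    ext x
    simp only [Set.mem_preimage, Set.mem_pi, Set.mem_prod, Finset.mem_coe, Finset.mem_range, B']
    constructor
    · intro h
      refine ⟨?_, fun k _ => ?_⟩
      · split_ifs with h0
        · exact h 0 h0
        · trivial
      · split_ifs with h0
        · exact h (k + 1) h0
        · trivial
    · rintro ⟨h0, h1⟩ i hi
      cases i with
      | zero => simpa [hi, consSeq] using h0
      | succ k =>
        have hk := Finset.mem_range.1 (hN hi)
        simpa [hi, consSeq] using h1 k (by omega)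
  rw [Measure.map_apply measurable_consSeq (MeasurableSet.pi s.countable_toSet fun i _ => hB i),
    hpre, Measure.prod_prod, Measure.infinitePi_pi _ fun i _ => hB' (i + 1), mul_comm,
    ← Finset.prod_range_succ' fun i => μ (B' i), ← Finset.prod_subset hN]
  · exact Finset.prod_congr rfl fun i hi => by simp [B', hi]
  · intro i _ hi
    simp [B', hi]

variable {t n : ℕ}

/-- The law of the outcomes of one round. -/
noncomputable def Problem.roundLaw (P : Problem ℝ t n) : Measure (Fin n × Fin t → Bool) :=
  Measure.pi fun a : Fin n × Fin t => ProbabilityTheory.bernoulliMeasure true false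
    (⟨P.p a.1 a.2, P.p_nonneg a.1 a.2, P.p_le_one a.1 a.2⟩ : unitInterval)

instance (P : Problem ℝ t n) : IsProbabilityMeasure P.roundLaw := by
  unfold Problem.roundLaw
  infer_instance

instance (P : Problem ℝ t n) : IsProbabilityMeasure P.law := by
  unfold Problem.law
  infer_instance

theorem Problem.roundLaw_singleton (P : Problem ℝ t n) (o : Fin n × Fin t → Bool) :
    P.roundLaw {o} = ENNReal.ofReal (P.weight o) := by
  rw [Problem.roundLaw, Measure.pi_singleton, Problem.weight, ENNReal.ofReal_prod_of_nonneg]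
  · refine Finset.prod_congr rfl fun a _ => ?_
    rw [ProbabilityTheory.bernoulliMeasure_apply _ (measurableSet_singleton _)]
    have h0 := P.p_nonneg a.1 a.2
    have h1 := P.p_le_one a.1 a.2
    rw [← ENNReal.ofReal_toReal (a := ite _ _ _) (by split_ifs <;> simp)]
    cases o a <;> simp
  · intro a _
    split_ifs
    · exact P.p_nonneg _ _
    · exact sub_nonneg.2 (P.p_le_one _ _)

theorem measurableSet_head_tail (o : Fin n × Fin t → Bool) {B : Set (Outcomes t n)}
    (hB : MeasurableSet B) :
    MeasurableSet {ω : Outcomes t n | ω 0 = o ∧ (fun k => ω (k + 1)) ∈ B} := by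
  have hshift : Measurable fun (ω : Outcomes t n) (k : ℕ) => ω (k + 1) :=
    measurable_pi_lambda _ fun k => measurable_pi_apply (k + 1)
  have h0 : Measurable fun ω : Outcomes t n => ω 0 := measurable_pi_apply 0
  exact (h0 (measurableSet_singleton o)).inter (hshift hB)

theorem Problem.law_head_tail (P : Problem ℝ t n) (o : Fin n × Fin t → Bool)
    {B : Set (Outcomes t n)} (hB : MeasurableSet B) :
    P.law {ω | ω 0 = o ∧ (fun k => ω (k + 1)) ∈ B} = ENNReal.ofReal (P.weight o) * P.law B := by
  have hlaw : P.law = (P.roundLaw.prod P.law).map consSeq :=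
    (map_consSeq_prod_infinitePi P.roundLaw).symm
  rw [hlaw, Measure.map_apply measurable_consSeq (measurableSet_head_tail o hB), ← hlaw, ← P.roundLaw_singleton,
    ← Measure.prod_prod]
  rfl

end Law

/-! ### The expected completion time as a sum of tail probabilities -/

section Time

variable {K : Type} [Field K] [LinearOrder K] {t n : ℕ} {R : Regimen t n} {X : Finset (Fin t)}
  {ω : Outcomes t n}

theorem subset_executed (R : Regimen t n) (X : Finset (Fin t)) (ω : Outcomes t n) (k : ℕ) :
    X ⊆ executed R X ω k := by
  induction k with
  | zero => exact subset_rfl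
  | succ k ih => exact ih.trans Finset.subset_union_left

theorem executed_succ (R : Regimen t n) (X : Finset (Fin t)) (ω : Outcomes t n) (k : ℕ) :
    executed R X ω (k + 1) = executed R (X ∪ hit (R X) (ω 0)) (fun k => ω (k + 1)) k := by
  induction k with
  | zero => rfl
  | succ k ih => rw [executed, ih]; rfl

/-- The first time at which a persistent property holds is the number of times at which it fails;
both are `∞` if it never holds. -/
theorem iInf_eq_tsum_of_monotone (q : ℕ → Prop) [DecidablePred q] (hq : ∀ k, q k → q (k + 1)) :
    ⨅ (k : ℕ) (_ : q k), (k : ℝ≥0∞) = ∑' k, if q k then 0 else 1 := by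
  by_cases h : ∃ k, q k
  · have hmono : ∀ k, Nat.find h ≤ k → q k := fun k hk =>
      Nat.le_induction (Nat.find_spec h) (fun k _ => hq k) k hk
    rw [tsum_eq_sum (s := Finset.range (Nat.find h))]
    · rw [Finset.sum_congr rfl fun k hk => if_neg (Nat.find_min h (Finset.mem_range.1 hk))]
      simp only [Finset.sum_const, Finset.card_range, nsmul_eq_mul, mul_one]
      refine le_antisymm (iInf₂_le _ (Nat.find_spec h)) (le_iInf₂ fun k hk => ?_)
      exact_mod_cast Nat.find_min' h hk
    · intro k hk
      rw [if_pos (hmono k (by simpa using hk))]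
  · push Not at h
    simp [h]

theorem Problem.completionTime_eq_tsum (P : Problem K t n) (R : Regimen t n) (X : Finset (Fin t))
    (ω : Outcomes t n) : P.completionTime R X ω =
      ∑' k, if P.sinks ⊆ executed R X ω k then 0 else 1 :=
  iInf_eq_tsum_of_monotone _ fun _ h => h.trans Finset.subset_union_left

variable {P : Problem ℝ t n}

/-- The probability that, starting with `X`, some sink has not been executed after `k` rounds. -/
noncomputable def Problem.unfinished (P : Problem ℝ t n) (R : Regimen t n) (X : Finset (Fin t))
    (k : ℕ) : ℝ≥0∞ :=
  P.law {ω | ¬ P.sinks ⊆ executed R X ω k}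

theorem setOf_not_sinks_subset_executed_succ (P : Problem ℝ t n) (R : Regimen t n)
    (X : Finset (Fin t)) (k : ℕ) :
    {ω | ¬ P.sinks ⊆ executed R X ω (k + 1)} = ⋃ o, {ω | ω 0 = o ∧ (fun k => ω (k + 1)) ∈
      {ω | ¬ P.sinks ⊆ executed R (X ∪ hit (R X) o) ω k}} := by
  ext ω
  simp [executed_succ]

/-- Conditioning on the finitely many outcomes of the first round reduces `k + 1` rounds to `k`
rounds from another starting set. -/
theorem Problem.measurableSet_unfinished (P : Problem ℝ t n) (R : Regimen t n)
    (X : Finset (Fin t)) (k : ℕ) : MeasurableSet {ω | ¬ P.sinks ⊆ executed R X ω k} := by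
  induction k generalizing X with
  | zero => simp [executed]
  | succ k ih =>
    rw [setOf_not_sinks_subset_executed_succ]
    exact MeasurableSet.iUnion fun o => measurableSet_head_tail o (ih _)

theorem Problem.unfinished_succ (P : Problem ℝ t n) (R : Regimen t n) (X : Finset (Fin t))
    (k : ℕ) : P.unfinished R X (k + 1) =
      ∑ o, ENNReal.ofReal (P.weight o) * P.unfinished R (X ∪ hit (R X) o) k := by
  rw [Problem.unfinished, setOf_not_sinks_subset_executed_succ, measure_iUnion, tsum_fintype]
  · exact Finset.sum_congr rfl fun o _ => P.law_head_tail o (P.measurableSet_unfinished R _ k)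
  · intro o o' hne
    refine Set.disjoint_left.2 fun ω h h' => hne (h.1.symm.trans h'.1)
  · exact fun o => measurableSet_head_tail o (P.measurableSet_unfinished R _ k)

theorem Problem.unfinished_zero (P : Problem ℝ t n) (R : Regimen t n) (hX : P.Closed X)
    (hXu : X ≠ Finset.univ) : P.unfinished R X 0 = 1 := by
  have : ¬ P.sinks ⊆ X := fun h => hXu (hX.sinks_subset_iff.1 h)
  simp [Problem.unfinished, executed, this]

theorem Problem.unfinished_univ (P : Problem ℝ t n) (R : Regimen t n) (k : ℕ) :
    P.unfinished R Finset.univ k = 0 := by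
  have : ∀ ω, executed R Finset.univ ω k = Finset.univ := fun ω =>
    Finset.univ_subset_iff.1 (subset_executed R _ ω k)
  simp [Problem.unfinished, this]

theorem Problem.expectedTime_eq_tsum (P : Problem ℝ t n) (R : Regimen t n) :
    P.expectedTime R = ∑' k, P.unfinished R ∅ k := by
  simp only [Problem.expectedTime, Problem.completionTime_eq_tsum]
  have hind : ∀ k, (fun ω => if P.sinks ⊆ executed R ∅ ω k then (0 : ℝ≥0∞) else 1) =
      {ω | ¬ P.sinks ⊆ executed R ∅ ω k}.indicator 1 := by
    intro k
    ext ω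
    by_cases h : P.sinks ⊆ executed R ∅ ω k <;> simp [h]
  rw [lintegral_tsum]
  · refine tsum_congr fun k => ?_
    rw [hind, lintegral_indicator_one (P.measurableSet_unfinished R ∅ k)]
    rfl
  · intro k
    rw [hind]
    exact (measurable_one.indicator (P.measurableSet_unfinished R ∅ k)).aemeasurable

theorem Problem.ofReal_mean (P : Problem ℝ t n) {f : (Fin n × Fin t → Bool) → ℝ}
    (hf : ∀ o, 0 ≤ f o) :
    ENNReal.ofReal (P.mean f) = ∑ o, ENNReal.ofReal (P.weight o) * ENNReal.ofReal (f o) := by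
  rw [Problem.mean, ENNReal.ofReal_sum_of_nonneg fun o _ => mul_nonneg (P.weight_nonneg o) (hf o)]
  exact Finset.sum_congr rfl fun o _ => ENNReal.ofReal_mul (P.weight_nonneg o)

theorem Problem.ofReal_one_add_mean (P : Problem ℝ t n) {f : (Fin n × Fin t → Bool) → ℝ}
    (hf : ∀ o, 0 ≤ f o) : ENNReal.ofReal (1 + P.mean f) =
      1 + ∑ o, ENNReal.ofReal (P.weight o) * ENNReal.ofReal (f o) := by
  rw [ENNReal.ofReal_add zero_le_one, P.ofReal_mean hf, ENNReal.ofReal_one]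
  exact Finset.sum_nonneg fun o _ => mul_nonneg (P.weight_nonneg o) (hf o)

variable {S : Finset (Fin t) → ℝ}

/-- Truncating after `k` rounds permits an induction on `k` with the Bellman equation of `R`,
without knowing in advance that the expectation is finite. -/
theorem Problem.Solves.sum_unfinished_le (h : P.Solves R S) (k : ℕ) (hX : P.Closed X) :
    ∑ i ∈ Finset.range k, P.unfinished R X i ≤ ENNReal.ofReal (S X) := by
  induction k generalizing X with
  | zero => simp
  | succ k ih =>
    rcases eq_or_ne X Finset.univ with rfl | hXu
    · simp [P.unfinished_univ]
    have hat := h.at_closed X hX hXu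
    rw [Finset.sum_range_succ', P.unfinished_zero R hX hXu, hat.eq,
      P.ofReal_one_add_mean fun o => h.nonneg _, add_comm]
    simp only [P.unfinished_succ]
    rw [Finset.sum_comm]
    refine add_le_add le_rfl (Finset.sum_le_sum fun o _ => ?_)
    rw [← Finset.mul_sum]
    gcongr
    exact ih (hX.union (hat.admits.hit_subset o))

theorem Problem.Solves.expectedTime_le (h : P.Solves R S) :
    P.expectedTime R ≤ ENNReal.ofReal (S ∅) := by
  rw [P.expectedTime_eq_tsum, ENNReal.tsum_eq_iSup_nat]
  exact iSup_le fun k => h.sum_unfinished_le k P.closed_empty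

theorem Problem.tsum_unfinished (P : Problem ℝ t n) (R : Regimen t n) (hX : P.Closed X)
    (hXu : X ≠ Finset.univ) : ∑' k, P.unfinished R X k =
      1 + ∑ o, ENNReal.ofReal (P.weight o) * ∑' k, P.unfinished R (X ∪ hit (R X) o) k := by
  rw [tsum_eq_zero_add' ENNReal.summable, P.unfinished_zero R hX hXu]
  simp only [P.unfinished_succ, ← ENNReal.tsum_mul_left]
  rw [Summable.tsum_finsetSum fun _ _ => ENNReal.summable]

/-- Induction from larger sets to smaller ones. The round may leave `X` unchanged, where no
induction hypothesis is available; there the expected time `τ` itself, which may be assumed finite,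
is kept as an unknown. -/
theorem Problem.Solves.le_tsum_unfinished (h : P.Solves R S) {R' : Regimen t n}
    (hR' : P.IsRegimen R') (hX : P.Closed X) :
    ENNReal.ofReal (S X) ≤ ∑' k, P.unfinished R' X k := by
  induction hm : t - X.card using Nat.strong_induction_on generalizing X with
  | _ m ih =>
  rcases eq_or_ne X Finset.univ with rfl | hXu
  · simp [h.value_univ]
  have hadm : P.Admits X (R' X) := hR' X hX
  by_cases htop : ∑' k, P.unfinished R' X k = ⊤
  · simp [htop]
  obtain ⟨τ, hτ0, hτ⟩ : ∃ τ : ℝ, 0 ≤ τ ∧ ∑' k, P.unfinished R' X k = ENNReal.ofReal τ :=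
    ⟨_, ENNReal.toReal_nonneg, (ENNReal.ofReal_toReal htop).symm⟩
  set e : (Fin n × Fin t → Bool) → ℝ := fun o => if hit (R' X) o = ∅ then 1 else 0 with he
  -- A lower bound for the remaining time after the first round: `τ` if nothing is executed, the
  -- value `S` of the new set otherwise.
  set f : (Fin n × Fin t → Bool) → ℝ := fun o =>
    if hit (R' X) o = ∅ then τ else S (X ∪ hit (R' X) o) with hf
  have hf0 : ∀ o, 0 ≤ f o := fun o => by
    simp only [hf]
    split_ifs
    · exact hτ0
    · exact h.nonneg _
  have h1 : 1 + P.mean f ≤ τ := by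
    rw [← ENNReal.ofReal_le_ofReal_iff hτ0, ← hτ, P.tsum_unfinished R' hX hXu,
      P.ofReal_one_add_mean hf0]
    refine add_le_add le_rfl (Finset.sum_le_sum fun o _ => ?_)
    gcongr
    simp only [hf]
    split_ifs with ho
    · simp [ho, hτ]
    · refine ih _ ?_ (hX.union (hadm.hit_subset o)) rfl
      have h1 := Problem.card_lt_card_union (hadm.hit_subset o) (Finset.nonempty_iff_ne_empty.2 ho)
      have h2 := (X ∪ hit (R' X) o).card_le_univ
      simp only [Fintype.card_fin] at h2
      omega
  have h2 : S X ≤ 1 + (P.mean f + P.mean e * (S X - τ)) := by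
    rw [← P.mean_mul_const, ← P.mean_add]
    refine (h.le_of_admits hX hXu hadm).trans (add_le_add le_rfl (P.mean_mono fun o => ?_))
    simp only [hf, he]
    split_ifs with ho
    · simp [ho]
    · simp
  have h3 : P.mean e * τ ≤ P.mean f := by
    rw [← P.mean_mul_const]
    refine P.mean_mono fun o => ?_
    simp only [hf, he]
    split_ifs with ho
    · simp
    · simpa using h.nonneg _
  rw [hτ]
  refine ENNReal.ofReal_le_ofReal ?_
  -- If `τ < S X`, then `h1` and `h2` force the probability `P.mean e` of executing nothing to be at
  -- least `1`. But then `h3` gives `τ ≤ P.mean f`, contradicting `h1`.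
  by_contra! hlt
  have h4 : 1 ≤ P.mean e := by
    by_contra! h5
    nlinarith
  nlinarith

theorem Problem.Solves.isOptimal (h : P.Solves R S) :
    P.IsOptimal R ∧ P.expectedTime R < ⊤ := by
  refine ⟨⟨h.isRegimen, fun R' hR' => h.expectedTime_le.trans ?_⟩,
    h.expectedTime_le.trans_lt ENNReal.ofReal_lt_top⟩
  rw [P.expectedTime_eq_tsum]
  exact h.le_tsum_unfinished hR' P.closed_empty

end Time

/-! ## Running time of the topological sort -/

section SetTime

variable {t : ℕ}

/-- A list with `ℓ` elements satisfies the recurrence `T(ℓ + 1) = T(ℓ) + 3 * 2 ^ ℓ + 2` with `T(0) =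
1`. -/
theorem sublistsT_time_le {α : Type} (l : List α) : (sublistsT l).time + 5 ≤ 6 * 2 ^ l.length := by
  induction l with
  | nil => simp [sublistsT]
  | cons a l ih =>
    have h := mapT_time_le (T := 1) (f := fun x : List α => charge 1 (a :: x)) l.sublists' (by simp)
    rw [List.length_sublists'] at h
    simp only [sublistsT, time_bind, val_sublistsT, time_appendT, List.length_sublists',
      List.length_cons, pow_succ]
    have := Nat.one_le_two_pow (n := l.length)
    omega

theorem searchT_time_le (X : Finset (Fin t)) (l : List (Finset (Fin t))) :
    (searchT X l).time ≤ l.length * (t + 2) + 1 := by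
  induction l with
  | nil => simp [searchT]
  | cons Z l ih =>
    by_cases h : X = Z
    · simp [searchT, h, Nat.succ_mul]
      omega
    · simp [searchT, h, Nat.succ_mul]
      linarith

theorem insertT_time_le (X : Finset (Fin t)) (l : List (Finset (Fin t))) :
    (insertT X l).time ≤ l.length * (2 * t + 3) + 1 := by
  induction l with
  | nil => simp [insertT]
  | cons Z l ih =>
    by_cases h : X.card ≤ Z.card
    · simp [insertT, h, Nat.succ_mul]
      linarith [Nat.zero_le (l.length * (2 * t + 3))]
    · simp [insertT, h, Nat.succ_mul]
      linarith

/-- Time for the insertion sort of `N` sets. -/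
def sortTime (t N : ℕ) : ℕ := N * (N * (2 * t + 3) + 2) + 1

theorem sortT_time_le (l : List (Finset (Fin t))) {N : ℕ} (hl : l.length ≤ N) :
    (sortT l).time ≤ sortTime t N := by
  have h := (foldT_bound (T := N * (2 * t + 3) + 1) (f := fun acc X => insertT X acc)
    (fun i acc => acc.length = i) l [] 0 rfl fun i acc X _ hi _ hacc => ⟨?_, ?_⟩).1
  · refine h.trans ?_
    unfold sortTime
    gcongr
  · refine (insertT_time_le X acc).trans ?_
    gcongr
    omega
  · rw [(val_insertT_perm X acc).length_eq, List.length_cons, hacc]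

end SetTime

/-! ### Time for generating and sorting the nodes -/

section NodeTime

variable {K : Type} [Field K] [LinearOrder K] {t n w : ℕ} {P : Problem K t n} {X : Finset (Fin t)}

/-- Time for listing the eligible tasks. -/
def eligibleTime (t : ℕ) : ℕ := t + 1 + (t * (3 * t + 4) + 1)

theorem Problem.containsSinksT_time_le (P : Problem K t n) (X : Finset (Fin t)) :
    (P.containsSinksT X).time ≤ eligibleTime t := by
  have hinner : ∀ j, (allT (fun k => charge 1 (!P.arc j k)) (List.finRange t)).time ≤
      t * 2 + 1 := fun j => by
    simpa using allT_time_le (T := 1) (q := fun k => charge 1 (!P.arc j k)) (List.finRange t)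
      (by simp)
  have houter := allT_time_le (T := 3 * t + 3) (q := fun j => do
    let childless ← allT (fun k => charge 1 (!P.arc j k)) (List.finRange t)
    let b ← memT j X
    charge 1 (!childless || b)) (List.finRange t) fun j _ => by
      have := hinner j
      simp only [time_bind, time_memT, time_charge]
      omega
  rw [List.length_finRange] at houter
  exact Nat.add_le_add le_rfl houter

theorem Problem.eligibleT_time_le (P : Problem K t n) (X : Finset (Fin t)) :
    (P.eligibleT X).time ≤ eligibleTime t := by
  have hinner : ∀ j, (allT (fun i => do
      let b ← memT i X
      charge 1 (!P.arc i j || b)) (List.finRange t)).time ≤ t * 3 + 1 := fun j => by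
    simpa using allT_time_le (T := 2) (q := fun i => do
      let b ← memT i X
      charge 1 (!P.arc i j || b)) (List.finRange t) (by simp)
  have houter := filterT_time_le (T := 3 * t + 3) (q := fun j => do
    let parents ← allT (fun i => do
      let b ← memT i X
      charge 1 (!P.arc i j || b)) (List.finRange t)
    let b ← memT j X
    charge 1 (!b && parents)) (List.finRange t) fun j _ => by
      have := hinner j
      simp only [time_bind, time_memT, time_charge]
      omega
  rw [List.length_finRange] at houter
  exact Nat.add_le_add le_rfl houter

theorem Problem.length_eligibleT_le (hX : P.Closed X) (hw : P.width ≤ w) :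
    (P.eligibleT X).val.length ≤ w := by
  rw [P.length_eligibleT]
  exact (P.card_eligible_le_width hX).trans hw

/-- Time for listing the children of a node. -/
def childrenTime (t w : ℕ) : ℕ :=
  2 * eligibleTime t + 6 * 2 ^ w + (2 ^ w * 2 + 1) + (2 ^ w * (2 * t + 2) + 1)

theorem Problem.childrenT_bound (hX : P.Closed X) (hw : P.width ≤ w) :
    (P.childrenT X).time ≤ childrenTime t w ∧ (P.childrenT X).val.length ≤ 2 ^ w := by
  have h1 := P.containsSinksT_time_le X
  have h2 := P.eligibleT_time_le X
  have hE : 2 ^ (P.eligibleT X).val.length ≤ 2 ^ w :=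
    Nat.pow_le_pow_right (by norm_num) (Problem.length_eligibleT_le hX hw)
  have h3 := sublistsT_time_le (P.eligibleT X).val
  by_cases hs : P.sinks ⊆ X
  · simp only [Problem.childrenT, val_bind, time_bind, Problem.val_containsSinksT, hs,
      decide_true, if_true, val_charge, time_charge, childrenTime]
    simp
    omega
  · have h4 := filterT_time_le (T := 1) (q := fun D : List (Fin t) => charge 1 (!D.isEmpty))
      (P.eligibleT X).val.sublists' (by simp)
    rw [List.length_sublists'] at h4
    have h5 := mapT_time_le (T := 2 * t + 1) (f := fun D => unionT X D)
      ((P.eligibleT X).val.sublists'.filter fun D => !D.isEmpty) fun D hD => by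
        have hsub := List.mem_sublists'.1 (List.mem_filter.1 hD).1
        have h6 := hsub.length_le
        have h7 := (P.nodup_eligibleT X).length_le_card
        simp only [Fintype.card_fin] at h7
        simp only [time_unionT]
        omega
    have h6 : ((P.eligibleT X).val.sublists'.filter fun D => !D.isEmpty).length ≤ 2 ^ w := by
      refine (List.length_filter_le _ _).trans ?_
      rwa [List.length_sublists']
    simp only [Problem.childrenT, val_bind, time_bind, Problem.val_containsSinksT, hs,
      decide_false, Bool.false_eq_true, if_false, val_sublistsT, val_filterT, val_mapT, val_charge,
      List.length_map, childrenTime]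
    refine ⟨?_, h6⟩
    have h7 := h5.trans (Nat.add_le_add_right (Nat.mul_le_mul_right _ h6) 1)
    rw [show 2 * t + 1 + 1 = 2 * t + 2 from rfl] at h7
    omega

/-- Time for adding the children of a node to a list of at most `N` nodes. -/
def expandTime (t w N : ℕ) : ℕ := childrenTime t w + (2 ^ w * (N * (t + 2) + 3) + 1)

theorem Problem.Growing.length_le {nodes : List (Finset (Fin t))}
    {st : List (Finset (Fin t)) × List (Finset (Fin t))} (h : P.Growing nodes st)
    (hw : P.width ≤ w) : st.1.length ≤ (t + 1) ^ w :=
  (P.length_le_of_closed _ h.2.1 h.2.2).trans (Nat.pow_le_pow_right (by omega) hw)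

theorem Problem.expandT_time_le {nodes : List (Finset (Fin t))}
    {st : List (Finset (Fin t)) × List (Finset (Fin t))} (h : P.Growing nodes st)
    (hX : P.Closed X) (hw : P.width ≤ w) :
    (P.expandT st X).time ≤ expandTime t w ((t + 1) ^ w) := by
  obtain ⟨h1, h2⟩ := Problem.childrenT_bound hX hw
  have h3 := (foldT_bound (T := (t + 1) ^ w * (t + 2) + 2) (f := Ropas.addNewT)
    (fun _ st => P.Growing nodes st) (P.childrenT X).val st 0 h fun i st Y _ _ hY hst =>
      ⟨?_, hst.addNewT ((Problem.mem_childrenT.1 hY).closed hX)⟩).1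
  · simp only [Problem.expandT, time_bind, expandTime]
    refine Nat.add_le_add h1 (h3.trans ?_)
    gcongr
  · have h4 := (searchT_time_le Y st.1).trans
      (Nat.add_le_add_right (Nat.mul_le_mul_right _ (hst.length_le hw)) 1)
    simp only [Ropas.addNewT, time_bind]
    split_ifs <;> simp only [time_charge] <;> omega

/-- Time for the construction of at most `N` nodes. -/
def growTime (t w N k : ℕ) : ℕ := k * (N * (expandTime t w N + 1) + 2) + 1

/-- At every moment the listed nodes are distinct closed sets, so that the linear searches run
through at most `(t + 1) ^ w` sets; the frontier is part of the list. -/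
theorem Problem.growT_time_le (hw : P.width ≤ w) (k : ℕ) {nodes frontier : List (Finset (Fin t))}
    (hnodup : nodes.Nodup) (hclosed : ∀ X ∈ nodes, P.Closed X) (hsub : ∀ X ∈ frontier, X ∈ nodes)
    (hlen : frontier.length ≤ (t + 1) ^ w) :
    (P.growT k nodes frontier).time ≤ growTime t w ((t + 1) ^ w) k := by
  induction k generalizing nodes frontier with
  | zero => simp [Problem.growT, growTime]
  | succ k ih =>
    have hg : P.Growing nodes (nodes, []) := ⟨by simp, hnodup, hclosed⟩
    have hcl : ∀ X ∈ frontier, P.Closed X := fun X hX => hclosed X (hsub X hX)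
    obtain ⟨h1, h2⟩ := foldT_bound (T := expandTime t w ((t + 1) ^ w)) (f := P.expandT)
      (fun _ st => P.Growing nodes st) frontier (nodes, []) 0 hg fun i st X _ _ hX hst =>
        ⟨Problem.expandT_time_le hst (hcl X hX) hw, hst.expandT (hcl X hX)⟩
    have hlen2 := h2.length_le hw
    have h3 := h1.trans (Nat.add_le_add_right (Nat.mul_le_mul_right _ hlen) 1)
    obtain ⟨h4, h5, h6⟩ := h2
    have h7 := ih h5 h6 (fun X hX => by rw [h4]; exact List.mem_append_left _ hX) (by
      rw [h4, List.length_append] at hlen2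
      omega)
    rw [Problem.growT_succ]
    simp only [time_bind, time_charge, growTime, Nat.succ_mul] at h7 ⊢
    omega

/-- Time for the topological sort. -/
def topologicalSortTime (t w N : ℕ) : ℕ := t + 1 + (growTime t w N t + sortTime t N)

theorem Problem.topologicalSortT_time_le (hw : P.width ≤ w) :
    P.topologicalSortT.time ≤ topologicalSortTime t w ((t + 1) ^ w) := by
  have h1 : (P.growT t [∅] [∅]).time ≤ growTime t w ((t + 1) ^ w) t :=
    Problem.growT_time_le hw t (by simp) (by simpa using P.closed_empty) (by simp)
      (Nat.one_le_pow _ _ (by omega))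
  have hlen : (P.growT t [∅] [∅]).val.length ≤ (t + 1) ^ w := by
    rw [← (val_sortT_perm _).length_eq]
    exact P.length_topologicalSortT_le.trans (Nat.pow_le_pow_right (by omega) hw)
  exact Nat.add_le_add le_rfl (Nat.add_le_add h1 (sortT_time_le _ hlen))

end NodeTime

/-! ## Sizes of the numbers in OPT -/

section Sizes

variable {K : Type} [Field K] [LinearOrder K] {t n : ℕ}

/-- `Bd M V x` says that `x` is a fraction with denominator `M` and value at most `V`. Operations on
numbers whose denominators and values are at most `L` cost at most `C`. The probabilities have
denominator `B`. -/
structure Problem.Sizes (P : Problem K t n) (c : K → K → ℕ) (Bd : ℕ → ℕ → K → Prop)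
    (B L C : ℕ) : Prop where
  pos : 0 < B
  zero : ∀ M V, 0 < M → Bd M V 0
  one : Bd 1 1 1
  prob : ∀ i j, Bd B 1 (P.p i j)
  sub : ∀ M x, Bd M 1 x → Bd M 1 (1 - x)
  mul : ∀ M V x M' V' y, Bd M V x → Bd M' V' y → Bd (M * M') (V * V') (x * y)
  add : ∀ M V x V' y, Bd M V x → Bd M V' y → Bd M (V + V') (x + y)
  mono : ∀ M V x M' V', Bd M V x → M ∣ M' → 0 < M' → V ≤ V' → Bd M' V' x
  div : ∀ Q M V u d, 0 < Q → Bd (Q * M) V u → Bd Q 1 d → d ≠ 0 →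
    ∃ d', 0 < d' ∧ d' ≤ Q ∧ Bd (M * d') (V * Q) (u / d)
  cost : ∀ M V x M' V' y, Bd M V x → Bd M' V' y → M ≤ L → V ≤ L → M' ≤ L → V' ≤ L → c x y ≤ C

variable {P : Problem K t n} {c : K → K → ℕ} {Bd : ℕ → ℕ → K → Prop} {B L C N m w : ℕ}

/-- Time for the probability that all workers assigned to a task fail. -/
def failTime (m C : ℕ) : ℕ := m + 1 + (m * (1 + 2 * C + 1) + 1)

/-- Time for the probability that an assignment executes exactly a given set. -/
def probTime (m C : ℕ) : ℕ := m * (failTime m C + (m + 1) + 2 * C + 1) + 1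

/-- Time for the sum over all sets that an assignment can execute. -/
def sumTime (t N m C : ℕ) : ℕ :=
  6 * 2 ^ m + (2 ^ m * (probTime m C + (t + m + 1) + (N * (t + 2) + 1) + 2 * C + 1) + 1)

/-- Time for listing the tasks used by an assignment. -/
def assignedTime (m : ℕ) : ℕ := m + 1 + (m * (m + 2) + 1)

/-- Time for a candidate assignment. -/
def tryTime (t N m C : ℕ) : ℕ := assignedTime m + sumTime t N m C + probTime m C + 5 * C + 1

/-- Time for listing the candidate assignments. -/
def candidatesTime (t w m : ℕ) : ℕ :=
  eligibleTime t + (m * (w * ((w + 1) ^ m * (m + 3) + 3) + 1) + 1)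

/-- Time for processing a node. -/
def processTime (t w N m C : ℕ) : ℕ :=
  candidatesTime t w m + ((w + 1) ^ m * (tryTime t N m C + 1) + 1) + (m + 1)

/-- Time for the algorithm. -/
def optTime (t w N m C : ℕ) : ℕ :=
  topologicalSortTime t w N + (N + 1) + (m + 1) + (N * (processTime t w N m C + 1) + 1)

/-- Each of the `n` workers contributes at most one factor `B` to the denominator. -/
theorem Problem.failT_bound (h : P.Sizes c Bd B L C) (hn : n ≤ m) (hL : B ^ (n * n + 1) ≤ L)
    (A : Fin n → Fin t) (j : Fin t) :
    (P.failT c A j).time ≤ failTime m C ∧ Bd (B ^ n) 1 (P.failT c A j).val := by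
  have hBL : ∀ i ≤ n * n + 1, B ^ i ≤ L := fun i hi =>
    (Nat.pow_le_pow_right h.pos hi).trans hL
  have h1L : 1 ≤ L := by simpa using hBL 0 (by omega)
  obtain ⟨h1, h2⟩ := foldT_bound (T := 1 + 2 * C) (f := fun (x : K) (i : Fin n) =>
      if A i = j then do
        let f ← charge (1 + c 1 (P.p i j)) (1 - P.p i j)
        charge (c x f) (x * f)
      else charge 1 x)
    (fun i x => Bd (B ^ i) 1 x) (List.finRange n) 1 0 (by simpa using h.one)
    fun i x k _ hi _ hx => by
      rw [List.length_finRange, zero_add] at hi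
      have hnn : n ≤ n * n := Nat.le_mul_self n
      have hiL : B ^ i ≤ L := hBL i (by omega)
      have hB1 : B ≤ L := by simpa using hBL 1 (by omega)
      have hf := h.sub _ _ (h.prob k j)
      split_ifs
      · have c1 := h.cost _ _ _ _ _ _ h.one (h.prob k j) h1L h1L hB1 h1L
        have c2 := h.cost _ _ _ _ _ _ hx hf hiL h1L hB1 h1L
        refine ⟨?_, ?_⟩
        · simp only [time_bind, time_charge, val_charge]
          omega
        · exact h.mul _ _ _ _ _ _ hx hf
      · refine ⟨by simp only [time_charge]; omega, ?_⟩
        exact h.mono _ _ _ _ _ hx (pow_dvd_pow B (by omega)) (pow_pos h.pos _) le_rfl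
  rw [List.length_finRange, zero_add] at h2
  rw [List.length_finRange] at h1
  refine ⟨?_, h2⟩
  refine (Nat.add_le_add le_rfl h1 : (P.failT c A j).time ≤ (n + 1) + _).trans ?_
  unfold failTime
  gcongr

/-- At most `n` tasks are assigned, and each contributes a factor `B ^ n` to the denominator. -/
theorem Problem.probT_bound (h : P.Sizes c Bd B L C) (hn : n ≤ m) (hL : B ^ (n * n + 1) ≤ L)
    (A : Fin n → Fin t) {I D : List (Fin t)} (hI : I.length ≤ n) (hD : D.length ≤ n) :
    (P.probT c A I D).time ≤ probTime m C ∧ Bd (B ^ (n * n + 1)) 1 (P.probT c A I D).val := by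
  have hBL : ∀ i ≤ n * n + 1, B ^ i ≤ L := fun i hi =>
    (Nat.pow_le_pow_right h.pos hi).trans hL
  have h1L : 1 ≤ L := by simpa using hBL 0 (by omega)
  have hnn : n ≤ n * n := Nat.le_mul_self n
  obtain ⟨h1, h2⟩ := foldT_bound (T := failTime m C + (m + 1) + 2 * C)
    (f := fun (x : K) (j : Fin t) => do
      let f ← P.failT c A j
      let inD ← charge (D.length + 1) (decide (j ∈ D))
      if inD then
        let s ← charge (c 1 f) (1 - f)
        charge (c x s) (x * s)
      else charge (c x f) (x * f))
    (fun i x => Bd (B ^ (n * i)) 1 x) I 1 0 (by simpa using h.one)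
    fun i x j _ hi _ hx => by
      rw [zero_add] at hi
      obtain ⟨f1, f2⟩ := P.failT_bound h hn hL A j
      have hiL : B ^ (n * i) ≤ L := hBL _ ((Nat.mul_le_mul_left n (by omega : i ≤ n)).trans
        (by omega))
      have hnL : B ^ n ≤ L := hBL n (by omega)
      have c1 := h.cost _ _ _ _ _ _ h.one f2 h1L h1L hnL h1L
      have c2 := h.cost _ _ _ _ _ _ hx f2 hiL h1L hnL h1L
      have c3 := h.cost _ _ _ _ _ _ hx (h.sub _ _ f2) hiL h1L hnL h1L
      rw [Nat.mul_succ, pow_add]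
      by_cases hj : j ∈ D
      · refine ⟨?_, ?_⟩
        · simp only [time_bind, time_charge, val_charge, hj, decide_true, if_true]
          omega
        · simp only [val_bind, val_charge, hj, decide_true, if_true]
          exact h.mul _ _ _ _ _ _ hx (h.sub _ _ f2)
      · refine ⟨?_, ?_⟩
        · simp only [time_bind, time_charge, val_charge, hj, decide_false, Bool.false_eq_true,
            if_false]
          omega
        · simp only [val_bind, val_charge, hj, decide_false, Bool.false_eq_true, if_false]
          exact h.mul _ _ _ _ _ _ hx f2
  rw [zero_add] at h2
  refine ⟨h1.trans ?_, h.mono _ _ _ _ _ h2 (pow_dvd_pow B ?_) (pow_pos h.pos _) le_rfl⟩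
  · unfold probTime
    gcongr
    omega
  · have := Nat.mul_le_mul_left n hI
    omega

theorem lookupT_bound (h : P.Sizes c Bd B L C) {M V : ℕ} (hM : 0 < M) (S : Table K t n)
    (hS : ∀ e ∈ S, Bd M V e.2.1) (X : Finset (Fin t)) :
    (lookupT X S).time ≤ S.length * (t + 2) + 1 ∧ Bd M V (lookupT X S).val := by
  induction S with
  | nil => exact ⟨by simp [lookupT], h.zero M V hM⟩
  | cons e S ih =>
    obtain ⟨h1, h2⟩ := ih fun e he => hS e (by simp [he])
    by_cases hX : X = e.1
    · refine ⟨?_, by simpa [lookupT, hX] using hS e (by simp)⟩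
      simp [lookupT, hX, Nat.succ_mul]
      omega
    · refine ⟨?_, by simpa [lookupT, hX] using h2⟩
      simp [lookupT, hX, Nat.succ_mul]
      linarith

theorem length_assignedT_le (A : Fin n → Fin t) : (assignedT A).val.length ≤ n := by
  classical
  rw [← List.toFinset_card_of_nodup (nodup_assignedT A)]
  calc _ ≤ (Finset.univ.image A).card := Finset.card_le_card fun j hj => by
        simpa [mem_assignedT] using hj
    _ ≤ _ := Finset.card_image_le.trans (by simp)

theorem assignedT_time_le (A : Fin n → Fin t) (hn : n ≤ m) :
    (assignedT A).time ≤ assignedTime m := by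
  have h := (foldT_bound (T := n + 1) (f := fun (acc : List (Fin t)) i =>
      charge (acc.length + 1) (if A i ∈ acc then acc else A i :: acc))
    (fun i acc => acc.length ≤ i) (List.finRange n) [] 0 le_rfl fun i acc k _ hi _ hacc => by
      rw [List.length_finRange, zero_add] at hi
      refine ⟨by simp only [time_charge]; omega, ?_⟩
      simp only [val_charge]
      split_ifs
      · omega
      · rw [List.length_cons]
        omega).1
  rw [List.length_finRange] at h
  refine (Nat.add_le_add le_rfl h : (assignedT A).time ≤ (n + 1) + _).trans ?_
  unfold assignedTime
  have := Nat.mul_le_mul hn (by omega : n + 1 + 1 ≤ m + 2)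
  omega

theorem Problem.sumT_bound (h : P.Sizes c Bd B L C) (hn : n ≤ m) {M V : ℕ} (hM : 0 < M)
    (hML : B ^ (n * n + 1) * M ≤ L) (hVL : 2 ^ n * V ≤ L) (S : Table K t n)
    (hlen : S.length ≤ N) (hS : ∀ e ∈ S, Bd M V e.2.1) (Y : Finset (Fin t)) (A : Fin n → Fin t)
    {I : List (Fin t)} (hI : I.length ≤ n) :
    (P.sumT c S Y A I).time ≤ sumTime t N m C ∧
      Bd (B ^ (n * n + 1) * M) (2 ^ n * V) (P.sumT c S Y A I).val := by
  have hQ : 0 < B ^ (n * n + 1) := pow_pos h.pos _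
  have hQL : B ^ (n * n + 1) ≤ L := (Nat.le_mul_of_pos_right _ hM).trans hML
  have hML' : M ≤ L := (Nat.le_mul_of_pos_left _ hQ).trans hML
  have h1L : 1 ≤ L := hQ.trans_le hQL
  have hVL' : V ≤ L := (Nat.le_mul_of_pos_left _ (by positivity)).trans hVL
  have hsubl := sublistsT_time_le I
  have hI2 : 2 ^ I.length ≤ 2 ^ n := Nat.pow_le_pow_right (by norm_num) hI
  have hn2 : 2 ^ n ≤ 2 ^ m := Nat.pow_le_pow_right (by norm_num) hn
  obtain ⟨h1, h2⟩ := foldT_bound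
    (T := probTime m C + (t + m + 1) + (N * (t + 2) + 1) + 2 * C)
    (f := fun (sum : K) (D : List (Fin t)) =>
      if D.isEmpty then charge 1 sum
      else do
        let a ← P.probT c A I D
        let Z ← unionT Y D
        let s ← lookupT Z S
        let x ← charge (c a s) (a * s)
        charge (c sum x) (sum + x))
    -- All summands have the same denominator, so only the bound on the value grows: each term is a
    -- probability times a stored value at most `V`.
    (fun i x => Bd (B ^ (n * n + 1) * M) (i * V) x) I.sublists' 0 0
    (h.zero _ _ (Nat.mul_pos hQ hM)) fun i x D _ hi hD hx => by
      rw [List.length_sublists', zero_add] at hi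
      have hDlen : D.length ≤ n := (List.mem_sublists'.1 hD).length_le.trans hI
      have hiV : i * V ≤ L := (Nat.mul_le_mul_right V (by omega : i ≤ 2 ^ n)).trans hVL
      split_ifs
      · refine ⟨by simp only [time_charge]; omega, h.mono _ _ _ _ _ hx dvd_rfl
          (Nat.mul_pos hQ hM) (Nat.mul_le_mul_right V (by omega))⟩
      · obtain ⟨p1, p2⟩ := P.probT_bound h hn hQL A hI hDlen
        obtain ⟨l1, l2⟩ := lookupT_bound h hM S hS (Y ∪ D.toFinset)
        have hx2 := h.mul _ _ _ _ _ _ p2 l2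
        rw [one_mul] at hx2
        have c1 := h.cost _ _ _ _ _ _ p2 l2 hQL h1L hML' hVL'
        have c2 := h.cost _ _ _ _ _ _ hx hx2 hML hiV hML hVL'
        have l3 := l1.trans (Nat.add_le_add_right (Nat.mul_le_mul_right (t + 2) hlen) 1)
        refine ⟨?_, ?_⟩
        · simp only [time_bind, time_charge, val_charge, time_unionT, val_unionT]
          omega
        · simp only [val_bind, val_charge, val_unionT]
          rw [Nat.succ_mul]
          exact h.add _ _ _ _ _ hx hx2
  rw [List.length_sublists', zero_add] at h2
  rw [List.length_sublists'] at h1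
  constructor
  · simp only [Problem.sumT, time_bind, val_sublistsT]
    have h3 := h1.trans (Nat.add_le_add_right (Nat.mul_le_mul_right _ (hI2.trans hn2)) 1)
    unfold sumTime
    omega
  · simp only [Problem.sumT, val_bind, val_sublistsT]
    exact h.mono _ _ _ _ _ h2 dvd_rfl (Nat.mul_pos hQ hM) (Nat.mul_le_mul_right V hI2)

theorem Problem.tryT_bound (h : P.Sizes c Bd B L C) (hn : n ≤ m) {M V V' : ℕ} (hM : 0 < M)
    (hML : B ^ (n * n + 1) * M ≤ L) (hV : (1 + 2 ^ n * V) * B ^ (n * n + 1) ≤ V') (hV' : V' ≤ L)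
    (S : Table K t n) (hlen : S.length ≤ N) (hS : ∀ e ∈ S, Bd M V e.2.1) (Y : Finset (Fin t))
    (A : Fin n → Fin t) (best : Option (K × (Fin n → Fin t)))
    (hbest : ∀ b ∈ best, ∃ d, 0 < d ∧ d ≤ B ^ (n * n + 1) ∧ Bd (M * d) V' b.1) :
    (P.tryT c S Y best A).time ≤ tryTime t N m C ∧
      ∀ b ∈ (P.tryT c S Y best A).val,
        ∃ d, 0 < d ∧ d ≤ B ^ (n * n + 1) ∧ Bd (M * d) V' b.1 := by
  have hQ : 0 < B ^ (n * n + 1) := pow_pos h.pos _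
  have hQL : B ^ (n * n + 1) ≤ L := (Nat.le_mul_of_pos_right _ hM).trans hML
  have h1L : 1 ≤ L := hQ.trans_le hQL
  have hVL1 : 1 + 2 ^ n * V ≤ L := (Nat.le_mul_of_pos_right _ hQ).trans (hV.trans hV')
  have hVL2 : 2 ^ n * V ≤ L := (Nat.le_add_left _ _).trans hVL1
  have hdL : ∀ d, d ≤ B ^ (n * n + 1) → M * d ≤ L := fun d hd =>
    (Nat.mul_le_mul_left M hd).trans (by rwa [mul_comm])
  have hI := length_assignedT_le A
  have t1 := assignedT_time_le A hn
  obtain ⟨s1, s2⟩ := P.sumT_bound h hn hM hML hVL2 S hlen hS Y A hI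
  obtain ⟨p1, p2⟩ := P.probT_bound h hn hQL A hI (D := []) (by simp)
  set sum := (P.sumT c S Y A (assignedT A).val).val
  set a := (P.probT c A (assignedT A).val []).val
  have hd := h.sub _ _ p2
  have hu := h.add _ _ _ _ _
    (h.mono _ _ _ _ _ h.one (one_dvd _) (Nat.mul_pos hQ hM) le_rfl) s2
  have c1 := h.cost _ _ _ _ _ _ h.one p2 h1L h1L hQL h1L
  have c2 := h.cost _ _ _ _ _ _ hd (h.zero 1 1 one_pos) hQL h1L h1L h1L
  by_cases hd0 : 1 - a = 0
  · constructor
    · change (assignedT A).time + ((P.sumT c S Y A _).time + ((P.probT c A _ []).time + (c 1 a +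
        (c (1 - a) 0 + (if decide (1 - a = 0) = true then charge 1 best else _).time)))) ≤ _
      rw [if_pos (decide_eq_true hd0), time_charge]
      unfold tryTime
      omega
    · change ∀ b ∈ (if decide (1 - a = 0) = true then charge 1 best else _).val, _
      rwa [if_pos (decide_eq_true hd0)]
  · have hd0' : ¬ decide (1 - a = 0) = true := by simpa using hd0
    -- The factor `Q = B ^ (n * n + 1)` that the probabilities brought into the denominator is
    -- exchanged for some `d ≤ Q`. Each candidate has its own `d`.
    obtain ⟨d, hd1, hd2, hv⟩ := h.div _ _ _ _ _ hQ hu hd hd0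
    have hv' := h.mono _ _ _ (M * d) V' hv dvd_rfl (Nat.mul_pos hM hd1) hV
    have c3 := h.cost _ _ _ _ _ _ h.one s2 h1L h1L hML hVL2
    have c4 := h.cost _ _ _ _ _ _ hu hd hML hVL1 hQL h1L
    cases best with
    | none =>
      constructor
      · change (assignedT A).time + ((P.sumT c S Y A _).time + ((P.probT c A _ []).time + (c 1 a +
          (c (1 - a) 0 + (if decide (1 - a = 0) = true then _ else
            (do let u ← charge (c 1 sum) (1 + sum)
                let v ← charge (c u (1 - a)) (u / (1 - a))
                charge 1 (some (v, A)) : Timed (Option (K × (Fin n → Fin t))))).time)))) ≤ _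
        rw [if_neg hd0']
        simp only [time_bind, time_charge, val_charge]
        unfold tryTime
        omega
      · have hval : (P.tryT c S Y none A).val = some ((1 + sum) / (1 - a), A) := by
          change (if decide (1 - a = 0) = true then _ else
            (do let u ← charge (c 1 sum) (1 + sum)
                let v ← charge (c u (1 - a)) (u / (1 - a))
                charge 1 (some (v, A)) : Timed (Option (K × (Fin n → Fin t))))).val = _
          rw [if_neg hd0']
          rfl
        rw [hval]
        intro b hb
        rw [Option.mem_some_iff] at hb
        subst hb
        exact ⟨d, hd1, hd2, hv'⟩
    | some b =>
      obtain ⟨e, he1, he2, hb⟩ := hbest b rfl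
      have c5 := h.cost _ _ _ _ _ _ hv' hb (hdL d hd2) hV' (hdL e he2) hV'
      constructor
      · change (assignedT A).time + ((P.sumT c S Y A _).time + ((P.probT c A _ []).time + (c 1 a +
          (c (1 - a) 0 + (if decide (1 - a = 0) = true then _ else
            (do let u ← charge (c 1 sum) (1 + sum)
                let v ← charge (c u (1 - a)) (u / (1 - a))
                charge (c v b.1) (if v < b.1 then some (v, A) else some b) :
              Timed (Option (K × (Fin n → Fin t))))).time)))) ≤ _
        rw [if_neg hd0']
        simp only [time_bind, time_charge, val_charge]
        unfold tryTime
        omega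
      · have hval : (P.tryT c S Y (some b) A).val =
            if (1 + sum) / (1 - a) < b.1 then some ((1 + sum) / (1 - a), A) else some b := by
          change (if decide (1 - a = 0) = true then _ else
            (do let u ← charge (c 1 sum) (1 + sum)
                let v ← charge (c u (1 - a)) (u / (1 - a))
                charge (c v b.1) (if v < b.1 then some (v, A) else some b) :
              Timed (Option (K × (Fin n → Fin t))))).val = _
          rw [if_neg hd0']
          rfl
        rw [hval]
        intro b' hb'
        split_ifs at hb' <;> rw [Option.mem_some_iff] at hb' <;> subst hb'
        · exact ⟨d, hd1, hd2, hv'⟩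
        · exact ⟨e, he1, he2, hb⟩

/-- After `k` steps, the values have a common denominator at most `Q ^ k`, and they are at most
`(2 ^ (n + 1) * Q) ^ k`, where `Q = B ^ (n * n + 1)`. -/
def TableBound (Bd : ℕ → ℕ → K → Prop) (B k : ℕ) (S : Table K t n) : Prop :=
  S.length ≤ k ∧ ∃ M, 0 < M ∧ M ≤ (B ^ (n * n + 1)) ^ k ∧
    ∀ e ∈ S, Bd M ((2 ^ (n + 1) * B ^ (n * n + 1)) ^ k) e.2.1

theorem Problem.candidatesT_time_le (hn : n ≤ m) {Y : Finset (Fin t)} (hY : P.Closed Y)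
    (hw : P.width ≤ w) : (P.candidatesT Y).time ≤ candidatesTime t w m := by
  have h1 := P.eligibleT_time_le Y
  have h2 := assignmentsT_time_le (m := n) _ (Problem.length_eligibleT_le hY hw)
  refine (Nat.add_le_add h1 h2 : (P.candidatesT Y).time ≤ _).trans ?_
  unfold candidatesTime
  have : (w + 1) ^ n ≤ (w + 1) ^ m := Nat.pow_le_pow_right (by omega) hn
  gcongr

/-- Only the divisor `d` of the winning candidate enters the common denominator, which therefore
grows by a factor at most `Q` per node. The values grow by `2 ^ (n + 1) * Q`, since `(1 + 2 ^ n * V)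
* Q ≤ 2 ^ (n + 1) * Q * V` for `V ≥ 1`. -/
theorem Problem.processT_bound (h : P.Sizes c Bd B L C) (hn : n ≤ m) (hw : P.width ≤ w) {k : ℕ}
    (hk : k ≤ N) (hL : (2 ^ (n + 1) * B ^ (n * n + 1)) ^ (k + 1) ≤ L) {S : Table K t n}
    (hS : TableBound Bd B k S) {Y : Finset (Fin t)} (hY : P.Closed Y) :
    (P.processT c S Y).time ≤ processTime t w N m C ∧
      TableBound Bd B (k + 1) (P.processT c S Y).val := by
  obtain ⟨hlen, M, hM, hMk, hS⟩ := hS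
  set Q := B ^ (n * n + 1) with hQdef
  have hQ : 0 < Q := pow_pos h.pos _
  set V := (2 ^ (n + 1) * Q) ^ k with hVdef
  have hV1 : 1 ≤ V := Nat.one_le_pow _ _ (by positivity)
  have hML : Q * M ≤ L := by
    refine le_trans ?_ hL
    calc Q * M ≤ Q * Q ^ k := Nat.mul_le_mul_left Q hMk
      _ = Q ^ (k + 1) := by ring
      _ ≤ _ := Nat.pow_le_pow_left (Nat.le_mul_of_pos_left _ (by positivity)) _
  have hV : (1 + 2 ^ n * V) * Q ≤ (2 ^ (n + 1) * Q) ^ (k + 1) := by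
    rw [pow_succ (2 ^ (n + 1) * Q), ← hVdef]
    calc (1 + 2 ^ n * V) * Q ≤ (2 ^ n * V + 2 ^ n * V) * Q := by
          gcongr
          exact Nat.mul_pos (by positivity) hV1
      _ = V * (2 ^ (n + 1) * Q) := by ring
  have hstep := fun best A (hb : ∀ b ∈ best, ∃ d, 0 < d ∧ d ≤ Q ∧
      Bd (M * d) ((2 ^ (n + 1) * Q) ^ (k + 1)) b.1) =>
    P.tryT_bound h hn hM hML hV hL S (hlen.trans hk) hS Y A best hb
  obtain ⟨h1, h2⟩ := foldT_bound (T := tryTime t N m C) (f := fun best A => P.tryT c S Y best A)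
    (fun _ best => ∀ b ∈ best, ∃ d, 0 < d ∧ d ≤ Q ∧
      Bd (M * d) ((2 ^ (n + 1) * Q) ^ (k + 1)) b.1) (P.candidatesT Y).val none 0 (by simp)
    fun i best A _ _ _ hb => hstep best A hb
  have hc := Problem.candidatesT_time_le (P := P) hn hY hw
  have hclen : (P.candidatesT Y).val.length ≤ (w + 1) ^ m := by
    simp only [Problem.candidatesT, val_bind, length_assignmentsT]
    calc _ ≤ (w + 1) ^ n := Nat.pow_le_pow_left
          ((Problem.length_eligibleT_le hY hw).trans (by omega)) n
      _ ≤ _ := Nat.pow_le_pow_right (by omega) hn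
  have h3 := h1.trans (Nat.add_le_add_right (Nat.mul_le_mul_right _ hclen) 1)
  -- The old entries can be rewritten over the new common denominator, a multiple of `M`.
  have hmono : ∀ d, 0 < d → ∀ e ∈ S, Bd (M * d) ((2 ^ (n + 1) * Q) ^ (k + 1)) e.2.1 :=
    fun d hd e he => h.mono _ _ _ _ _ (hS e he) (Dvd.intro _ rfl) (Nat.mul_pos hM hd)
      (Nat.pow_le_pow_right (by positivity) (by omega))
  unfold processTime
  simp only [Problem.processT, time_bind, val_bind]
  generalize (foldT (fun best A => P.tryT c S Y best A) none (P.candidatesT Y).val) = r at h2 h3 ⊢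
  obtain ⟨best, time⟩ := r
  cases best with
  | none =>
    refine ⟨?_, by simp only [val_charge]; omega, M * 1, by omega, ?_, hmono 1 one_pos⟩
    · simp only [time_charge] at h3 ⊢
      omega
    · rw [mul_one]
      exact hMk.trans (Nat.pow_le_pow_right hQ (by omega))
  | some b =>
    obtain ⟨d, hd1, hd2, hb⟩ := h2 b rfl
    refine ⟨?_, by simp only [val_charge, List.length_cons]; omega, M * d, Nat.mul_pos hM hd1,
      ?_, ?_⟩
    · simp only [time_charge] at h3 ⊢
      omega
    · rw [pow_succ]
      exact Nat.mul_le_mul hMk hd2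
    · intro e he
      rcases List.mem_cons.1 he with rfl | he
      · exact hb
      · exact hmono d hd1 e he

theorem Problem.optT_time_le (h : P.Sizes c Bd B L C) (hn : n ≤ m) (hw : P.width ≤ w)
    (hL : (2 ^ (n + 1) * B ^ (n * n + 1)) ^ (t + 1) ^ w ≤ L) :
    (P.optT c).time ≤ optTime t w ((t + 1) ^ w) m C := by
  have ht := Problem.topologicalSortT_time_le hw
  have hlen : P.topologicalSortT.val.length ≤ (t + 1) ^ w :=
    P.length_topologicalSortT_le.trans (Nat.pow_le_pow_right (by omega) hw)
  have hcl : ∀ X ∈ P.topologicalSortT.val.reverse, P.Closed X := fun X hX =>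
    (P.topologicalSortT_spec.2.1 X).1 (List.mem_reverse.1 hX)
  unfold optTime
  simp only [Problem.optT, time_bind, val_reverseT, time_reverseT]
  have hlen' : P.topologicalSortT.val.reverse.length ≤ (t + 1) ^ w := by
    rwa [List.length_reverse]
  generalize P.topologicalSortT.val.reverse = Zs at hcl hlen' ⊢
  cases Zs with
  | nil =>
    simp only [time_charge]
    omega
  | cons Ym rest =>
    rw [List.length_cons] at hlen'
    have hQ : 0 < B ^ (n * n + 1) := pow_pos h.pos _
    obtain ⟨h1, -⟩ := foldT_bound (T := processTime t w ((t + 1) ^ w) m C)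
      (f := fun S Y => P.processT c S Y) (fun k S => TableBound Bd B k S) rest
      -- The count starts at `1` for the entry of `Ym`, so that it ends at the number of nodes.
      [(Ym, 0, fun _ => none)] 1
      ⟨by simp, 1, one_pos, Nat.one_le_pow _ _ hQ, by simpa using h.zero _ _ one_pos⟩
      fun k S Y _ hk hY hS => P.processT_bound h hn hw (by omega)
        ((Nat.pow_le_pow_right (by positivity) (by omega)).trans hL) hS (hcl Y (by simp [hY]))
    have h2 := h1.trans (Nat.add_le_add_right (Nat.mul_le_mul_right _
      (by omega : rest.length ≤ (t + 1) ^ w)) 1)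
    simp only [time_bind, time_charge, val_charge]
    omega

end Sizes

/-! ### The two cost models as instances of `Sizes` -/

section Instances

variable {t n : ℕ}

theorem Problem.sizes_unitCost (P : Problem ℝ t n) (L : ℕ) :
    P.Sizes (unitCost ℝ) (fun _ _ _ => True) 1 L 1 where
  pos := one_pos
  zero _ _ _ := trivial
  one := trivial
  prob _ _ := trivial
  sub _ _ _ := trivial
  mul _ _ _ _ _ _ _ _ := trivial
  add _ _ _ _ _ _ _ := trivial
  mono _ _ _ _ _ _ _ _ _ := trivial
  div Q _ _ _ _ hQ _ _ _ := ⟨Q, hQ, le_rfl, trivial⟩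
  cost _ _ _ _ _ _ _ _ _ _ _ _ := le_rfl

/-- `x` is a fraction with denominator `M`, and it lies between `0` and `V`. -/
def FractionBound (M V : ℕ) (x : ℚ) : Prop :=
  0 < M ∧ x ≤ V ∧ ∃ k : ℕ, x = k / M

/-- The reduced denominator divides `M`, and the reduced numerator is at most `V * M ≤ 2 ^ (2 * β)`.
-/
theorem FractionBound.bits_le {M V β : ℕ} {x : ℚ} (h : FractionBound M V x) (hM : M ≤ 2 ^ β)
    (hV : V ≤ 2 ^ β) : bits x ≤ 3 * β + 2 := by
  obtain ⟨hM0, hxV, k, rfl⟩ := h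
  have hM0' : (0 : ℚ) < M := by exact_mod_cast hM0
  have hden : ((k : ℚ) / M).den ∣ M := by
    have h := Rat.den_dvd k M
    rwa [Rat.divInt_eq_div, Int.cast_natCast, Int.cast_natCast, Int.natCast_dvd_natCast] at h
  have hdenM := Nat.le_of_dvd hM0 hden
  have hnum : ((k : ℚ) / M).num.natAbs ≤ 2 ^ (2 * β) := by
    have h0 : 0 ≤ ((k : ℚ) / M).num := Rat.num_nonneg.2 (by positivity)
    have h1 : (((k : ℚ) / M).num : ℚ) = (k : ℚ) / M * ((k : ℚ) / M).den := (Rat.mul_den_eq_num _).symm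
    have h2 : (((k : ℚ) / M).num : ℚ) ≤ V * M := by
      rw [h1]
      gcongr
    have h3 : ((k : ℚ) / M).num ≤ (V * M : ℕ) := by exact_mod_cast h2
    calc _ ≤ V * M := by omega
      _ ≤ 2 ^ β * 2 ^ β := Nat.mul_le_mul hV hM
      _ = _ := by rw [← pow_add, two_mul]
  have h1 : Nat.size ((k : ℚ) / M).num.natAbs ≤ 2 * β + 1 :=
    Nat.size_le.2 (hnum.trans_lt (Nat.pow_lt_pow_right (by norm_num) (by omega)))
  have h2 : Nat.size ((k : ℚ) / M).den ≤ β + 1 :=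
    Nat.size_le.2 ((hdenM.trans hM).trans_lt (Nat.pow_lt_pow_right (by norm_num) (by omega)))
  unfold bits
  omega

/-- A common denominator of the probabilities. -/
def Problem.denominator (P : Problem ℚ t n) : ℕ := ∏ i, ∏ j, (P.p i j).den

/-- A product of denominators has at most as many bits as all its factors together, so no least
common multiple is needed. -/
theorem Problem.denominator_le (P : Problem ℚ t n) : P.denominator ≤ 2 ^ P.size := by
  calc P.denominator ≤ ∏ i, ∏ j, 2 ^ bits (P.p i j) := by
        refine Finset.prod_le_prod' fun i _ => Finset.prod_le_prod' fun j _ => ?_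
        exact (Nat.lt_size_self _).le.trans
          (Nat.pow_le_pow_right (by norm_num) (Nat.le_add_left _ _))
    _ = 2 ^ ∑ i, ∑ j, bits (P.p i j) := by simp only [Finset.prod_pow_eq_pow_sum]
    _ ≤ _ := Nat.pow_le_pow_right (by norm_num) (Nat.le_add_left _ _)

theorem Problem.sizes_bitCost (P : Problem ℚ t n) (β : ℕ) :
    P.Sizes bitCost FractionBound P.denominator (2 ^ β) ((2 * (3 * β + 2)) ^ 2) where
  pos := Finset.prod_pos fun i _ => Finset.prod_pos fun j _ => (P.p i j).den_pos
  zero M V hM := ⟨hM, by simp, 0, by simp⟩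
  one := ⟨one_pos, by simp, 1, by simp⟩
  prob i j := by
    have hdvd : (P.p i j).den ∣ P.denominator :=
      (Finset.dvd_prod_of_mem (fun j => (P.p i j).den) (Finset.mem_univ j)).trans
        (Finset.dvd_prod_of_mem (fun i => ∏ j, (P.p i j).den) (Finset.mem_univ i))
    have hpos : 0 < P.denominator :=
      Finset.prod_pos fun i _ => Finset.prod_pos fun j _ => (P.p i j).den_pos
    obtain ⟨r, hr⟩ := hdvd
    have hr0 : (r : ℚ) ≠ 0 := by
      rintro h
      rw [Nat.cast_eq_zero] at h
      simp [hr, h] at hpos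
    refine ⟨hpos, by simpa using P.p_le_one i j, (P.p i j).num.toNat * r, ?_⟩
    have hnum : (((P.p i j).num.toNat : ℤ) : ℚ) = (P.p i j).num := by
      rw [Int.toNat_of_nonneg (Rat.num_nonneg.2 (P.p_nonneg i j))]
    rw [hr]
    push_cast at hnum ⊢
    rw [hnum, mul_div_mul_right _ _ hr0, Rat.num_div_den]
  sub M x := by
    rintro ⟨hM, hx, k, rfl⟩
    have hM' : (0 : ℚ) < M := by exact_mod_cast hM
    have hk : k ≤ M := by
      rw [Nat.cast_one, div_le_one hM'] at hx
      exact_mod_cast hx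
    refine ⟨hM, by simp; positivity, M - k, ?_⟩
    rw [Nat.cast_sub hk, sub_div, div_self hM'.ne']
  mul M V x M' V' y := by
    rintro ⟨hM, hx, k, rfl⟩ ⟨hM', hy, k', rfl⟩
    refine ⟨Nat.mul_pos hM hM', ?_, k * k', ?_⟩
    · rw [Nat.cast_mul]
      gcongr
    · push_cast
      rw [div_mul_div_comm]
  add M V x V' y := by
    rintro ⟨hM, hx, k, rfl⟩ ⟨_, hy, k', rfl⟩
    refine ⟨hM, ?_, k + k', ?_⟩
    · rw [Nat.cast_add]
      gcongr
    · push_cast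
      rw [add_div]
  mono M V x M' V' := by
    rintro ⟨hM, hx, k, rfl⟩ ⟨r, rfl⟩ hM' hV
    have hr : (r : ℚ) ≠ 0 := by
      rintro h
      rw [Nat.cast_eq_zero] at h
      simp [h] at hM'
    refine ⟨hM', hx.trans (by exact_mod_cast hV), k * r, ?_⟩
    push_cast
    rw [mul_div_mul_right _ _ hr]
  div Q M V u d := by
    rintro hQ ⟨hQM, hu, k, rfl⟩ ⟨_, hd, l, rfl⟩ hd0
    have hQ' : (0 : ℚ) < Q := by exact_mod_cast hQ
    have hM : 0 < M := Nat.pos_of_mul_pos_left hQM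
    have hM' : (0 : ℚ) < M := by exact_mod_cast hM
    have hl : 0 < l := by
      rcases Nat.eq_zero_or_pos l with rfl | h
      · simp at hd0
      · exact h
    have hl' : (1 : ℚ) ≤ l := by exact_mod_cast hl
    rw [Nat.cast_one, div_le_one hQ'] at hd
    refine ⟨l, hl, by exact_mod_cast hd, Nat.mul_pos hM hl, ?_, k, ?_⟩
    -- As `d = l / Q` is nonzero, it is at least `1 / Q`, so dividing by it multiplies the value by
    -- at most `Q`.
    · rw [div_le_iff₀ (by positivity)]
      calc _ ≤ (V : ℚ) := hu
        _ ≤ V * l := le_mul_of_one_le_right (by positivity) hl'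
        _ = _ := by
          push_cast
          field_simp
    · push_cast
      field_simp
  cost M V x M' V' y := by
    intro hx hy hM hV hM' hV'
    have h1 := hx.bits_le hM hV
    have h2 := hy.bits_le hM' hV'
    exact Nat.pow_le_pow_left (by omega) 2

end Instances

/-! ## Polynomial bounds -/

section Polynomial

theorem optTime_mono {t t' w N N' m C C' : ℕ} (ht : t ≤ t') (hN : N ≤ N') (hC : C ≤ C') :
    optTime t w N m C ≤ optTime t' w N' m C' := by
  unfold optTime topologicalSortTime growTime expandTime childrenTime sortTime processTime
    candidatesTime tryTime sumTime probTime failTime eligibleTime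
  gcongr

/-- The function is given by a polynomial. -/
def IsPolynomial (f : ℕ → ℕ) : Prop := ∃ q : Polynomial ℕ, ∀ x, q.eval x = f x

theorem IsPolynomial.const (a : ℕ) : IsPolynomial fun _ => a := ⟨.C a, by simp⟩

theorem IsPolynomial.id : IsPolynomial fun x => x := ⟨.X, by simp⟩

theorem IsPolynomial.add {f g : ℕ → ℕ} (hf : IsPolynomial f) (hg : IsPolynomial g) :
    IsPolynomial fun x => f x + g x := by
  obtain ⟨p, hp⟩ := hf
  obtain ⟨q, hq⟩ := hg
  exact ⟨p + q, by simp [hp, hq]⟩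

theorem IsPolynomial.mul {f g : ℕ → ℕ} (hf : IsPolynomial f) (hg : IsPolynomial g) :
    IsPolynomial fun x => f x * g x := by
  obtain ⟨p, hp⟩ := hf
  obtain ⟨q, hq⟩ := hg
  exact ⟨p * q, by simp [hp, hq]⟩

theorem IsPolynomial.pow {f : ℕ → ℕ} (hf : IsPolynomial f) (k : ℕ) :
    IsPolynomial fun x => f x ^ k := by
  obtain ⟨p, hp⟩ := hf
  exact ⟨p ^ k, by simp [hp]⟩

theorem isPolynomial_optTime (w m : ℕ) {C : ℕ → ℕ} (hC : IsPolynomial C) :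
    IsPolynomial fun x => optTime x w ((x + 1) ^ w) m (C x) := by
  unfold optTime topologicalSortTime growTime expandTime childrenTime sortTime processTime
    candidatesTime tryTime sumTime probTime failTime eligibleTime
  repeat' first
    | exact hC
    | exact .const _
    | exact .id
    | apply IsPolynomial.add
    | apply IsPolynomial.mul
    | apply IsPolynomial.pow

/-- A bound on the logarithms of numerators and denominators in OPT. -/
def logBound (w m s : ℕ) : ℕ := (m + 1 + s * (m * m + 1)) * (s + 1) ^ w

theorem isPolynomial_logBound (w m : ℕ) : IsPolynomial fun s => logBound w m s := by
  unfold logBound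
  repeat' first
    | exact .const _
    | exact .id
    | apply IsPolynomial.add
    | apply IsPolynomial.mul
    | apply IsPolynomial.pow

/-- All numerical bounds in OPT are at most `2 ^ β` with `β` polynomial in the size, which is what
`sizes_bitCost` requires. -/
theorem Problem.pow_le_two_pow_logBound {t n w m : ℕ} (P : Problem ℚ t n) (hn : n ≤ m) :
    (2 ^ (n + 1) * P.denominator ^ (n * n + 1)) ^ (t + 1) ^ w ≤ 2 ^ logBound w m P.size := by
  have ht : t ≤ P.size := by
    unfold Problem.size
    omega
  calc _ ≤ (2 ^ (n + 1) * (2 ^ P.size) ^ (n * n + 1)) ^ (t + 1) ^ w := by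
        gcongr
        exact P.denominator_le
    _ = 2 ^ ((n + 1 + P.size * (n * n + 1)) * (t + 1) ^ w) := by
        rw [← pow_mul, ← pow_add, ← pow_mul]
    _ ≤ _ := by
        refine Nat.pow_le_pow_right (by norm_num) ?_
        unfold logBound
        gcongr

end Polynomial

end Ropas

theorem mainTheorem1 :
    -- the states over which OPT runs, and the assignments tried at each of them
    (∀ (t n : ℕ) (P : Ropas.Problem ℝ t n),
      (∀ X, P.Node X ↔ P.Closed X) ∧
      P.IsTopologicalSort P.topologicalSortT.val ∧
      P.topologicalSortT.val.length ≤ (t + 1) ^ P.width ∧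
      ∀ X, P.Node X → (P.candidatesT X).val.length ≤ t ^ n) ∧
    -- OPT solves ROPAS, for real and (in exact rational arithmetic) for rational probabilities
    (∀ (t n : ℕ) (P : Ropas.Problem ℝ t n),
      P.IsOptimal (P.optRegimen (Ropas.unitCost ℝ)) ∧
      P.expectedTime (P.optRegimen (Ropas.unitCost ℝ)) < ⊤) ∧
    (∀ (t n : ℕ) (P : Ropas.Problem ℚ t n),
      P.toReal.IsOptimal (P.optRegimen Ropas.bitCost) ∧
      P.toReal.expectedTime (P.optRegimen Ropas.bitCost) < ⊤) ∧
    -- polynomial time for bounded width and number of workers: with arithmetic at unit cost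
    (∀ w m : ℕ, ∃ q : Polynomial ℕ, ∀ (t n : ℕ) (P : Ropas.Problem ℝ t n),
      P.width ≤ w → n ≤ m → (P.optT (Ropas.unitCost ℝ)).time ≤ q.eval t) ∧
    -- and, for rational probabilities, in the number of bit operations
    (∀ w m : ℕ, ∃ q : Polynomial ℕ, ∀ (t n : ℕ) (P : Ropas.Problem ℚ t n),
      P.width ≤ w → n ≤ m → (P.optT Ropas.bitCost).time ≤ q.eval P.size) := by
  refine ⟨fun t n P => ⟨P.node_iff_closed, P.isTopologicalSort, P.length_topologicalSortT_le,
      fun X _ => P.length_candidatesT_le X⟩, fun t n P => ?_, fun t n P => ?_, fun w m => ?_,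
      fun w m => ?_⟩
  · obtain ⟨S, hS⟩ := P.solves_optRegimen (Ropas.unitCost ℝ)
    exact hS.isOptimal
  · obtain ⟨S, hS⟩ := P.solves_optRegimen Ropas.bitCost
    exact hS.toReal.isOptimal
  · obtain ⟨q, hq⟩ := Ropas.isPolynomial_optTime w m (.const 1)
    refine ⟨q, fun t n P hw hn => ?_⟩
    rw [hq]
    exact Ropas.Problem.optT_time_le (P.sizes_unitCost _) hn hw le_rfl
  -- The cost of one operation is `(2 * (3 * β + 2)) ^ 2` with `β = logBound w m s`: two operands
  -- with at most `3 * β + 2` bits each.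
  · obtain ⟨q, hq⟩ := Ropas.isPolynomial_optTime w m
      (((Ropas.IsPolynomial.const 2).mul (((Ropas.IsPolynomial.const 3).mul
        (Ropas.isPolynomial_logBound w m)).add (.const 2))).pow 2)
    refine ⟨q, fun t n P hw hn => ?_⟩
    have ht : t ≤ P.size := by
      unfold Ropas.Problem.size
      omega
    rw [hq]
    refine (Ropas.Problem.optT_time_le (P.sizes_bitCost (Ropas.logBound w m P.size)) hn hw
      (P.pow_le_two_pow_logBound hn)).trans (Ropas.optTime_mono ht ?_ le_rfl)
    exact Nat.pow_le_pow_left (by omega) w
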